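/- Let $(W,S)$ be a finite Coxeter system of rank $n$ with set of reflections $T$, absolute length $\ell$ (word length with respect to $T$) and absolute order ($v\le w$ iff $\ell(w)=\ell(v)+\ell(v^{-1}w)$). Let $c$ be a Coxeter element (a conjugate of a product of all elements of $S$ in some order), let $\mathrm{NC}=\{w\in W: w\le c\}$ be the poset of non-crossing partitions, and let $c=lr$ with $l^2=r^2=1$. Let $\mathcal D=\langle\varphi_l,\varphi_r\rangle\le\mathrm{Aut}(\mathrm{NC})$, where $\varphi_l(w)=lw^{-1}l$ and $\varphi_r(w)=rw^{-1}r$. Consider either of the following two settings. (1) $\mathbb F=\mathbb R$, $V$ is the space of the geometric representation of $W$ (with the simple roots $\alpha_s$, $s\in S$, of length one as a basis), and $f(w)=\mathrm{mov}(w)=\mathrm{im}(w-\mathrm{id})$. (2) $W$ carries a (reduced) crystallographic root system $\Phi$ with simple roots $\alpha_s$, obtained from the roots of the geometric representation by rescaling; $p$ is a prime compatible with $\Phi$, meaning that every basis of the real space consisting of positive roots, written in coordinates with respect to the simple roots, reduces modulo $p$ to a basis; $\mathbb F=\mathbb F_p$, $V=\mathbb F_p^S$, and $f(w)$ is the reduction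 modulo $p$ of the group of integer vectors (in the simple root coordinates) in $\mathrm{mov}(w)$. For $t\in T$ let $\alpha_t\in V$ denote the root with reflection $t$ (its reduction modulo $p$ in setting (2)), which is determined up to sign. Let $\Lambda(V)$ be the lattice of linear subspaces of $V$, and let $|\mathrm{NC}|$ and $|\Lambda(V)|$ be the order complexes (simplices are chains of elements other than the minimum and the maximum), the type of a vertex being its rank, that is, $\ell(w)$ or $\dim U$ respectively. Then for every $\varphi\in\mathcal D$ the following hold. (a) $\varphi$ induces a type-preserving simplicial automorphism $|\varphi|$ of $|\mathrm{NC}|$. (b) There is a linear automorphism $\psi$ of $V$ with $\psi(\alpha_t)=\pm\alpha_{\varphi(t)}$ for all reflections $t\in\mathrm{NC}$, such that the lattice automorphism $\Psi\colon U\mapsto\psi(U)$ of $\Lambda(V)$ extends $\varphi$, that is, $\Psi\circ f=f\circ\varphi$. (c) $f$ maps vertices of $|\mathrm{NC}|$ to vertices of $|\Lambda(V)|$, and $\Psi$ induces a type-preserving simplicial automorphism of the building $|\Lambda(V)|$ that extends $|\varphi|$ along $f$. (d) If $W$ is irreducible, then $\Psi$ is the only extension of $\varphi$ to a lattice automorphism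 of $\Lambda(V)$ that is induced by a linear automorphism of $V$. (e) If $W$ is irreducible and $n\neq 2$, then $\Psi$ is the only extension of $\varphi$ to a lattice automorphism of $\Lambda(V)$, and the automorphism it induces on $|\Lambda(V)|$ is the only type-preserving simplicial automorphism of $|\Lambda(V)|$ that extends $|\varphi|$. -/

import Mathlib

/-! ### Order complexes and their automorphisms -/

/-- The elements of a bounded poset different from its minimum and its maximum. -/
abbrev ProperPart (P : Type*) [PartialOrder P] [BoundedOrder P] : Type _ :=
  {x : P // x ≠ ⊥ ∧ x ≠ ⊤}

/-- The order complex `|P|`: its vertices are the elements of `P` other than the minimum and the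
maximum, and its simplices are the finite (nonempty) chains of such elements. -/
def orderComplex (P : Type*) [PartialOrder P] [BoundedOrder P] :
    AbstractSimplicialComplex (ProperPart P) where
  faces := {s | s.Nonempty ∧ IsChain (· ≤ ·) (s : Set (ProperPart P))}
  isRelLowerSet_faces := by
    intro s hs
    refine ⟨hs.1, fun t hts ht => ⟨ht, hs.2.mono ?_⟩⟩
    exact_mod_cast hts
  singleton_mem v := by simp

/-- The group of automorphisms of a simplicial complex (bijections of the vertex set mapping
simplices to simplices in both directions) that preserve a given labelling of the vertices. -/
def typePreservingAut {ι : Type*} (K : AbstractSimplicialComplex ι) (type : ι → ℕ) :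
    Subgroup (Equiv.Perm ι) where
  carrier := {θ | (∀ s : Finset ι, s.map θ.toEmbedding ∈ K.faces ↔ s ∈ K.faces) ∧
    ∀ v, type (θ v) = type v}
  one_mem' := by
    refine ⟨fun s => ?_, fun v => rfl⟩
    have : s.map (1 : Equiv.Perm ι).toEmbedding = s := Finset.map_refl
    rw [this]
  mul_mem' := by
    rintro a b ⟨ha, ha'⟩ ⟨hb, hb'⟩
    refine ⟨fun s => ?_, fun v => by rw [Equiv.Perm.mul_apply, ha', hb']⟩
    have : s.map (a * b).toEmbedding = (s.map b.toEmbedding).map a.toEmbedding := by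
      rw [Finset.map_map]
      rfl
    rw [this, ha, hb]
  inv_mem' := by
    rintro a ⟨ha, ha'⟩
    refine ⟨fun s => ?_, fun v => ?_⟩
    · rw [← ha]
      have : (s.map a⁻¹.toEmbedding).map a.toEmbedding = s := by
        rw [Finset.map_map]
        convert Finset.map_refl
        ext v
        exact a.apply_symm_apply v
      rw [this]
    · rw [← ha', ← Equiv.Perm.mul_apply, mul_inv_cancel, Equiv.Perm.one_apply]

/-- The action on the vertices of the order complex of an automorphism of a bounded poset. -/
def properPerm {P : Type*} [PartialOrder P] [BoundedOrder P] (φ : P ≃o P) :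
    Equiv.Perm (ProperPart P) :=
  φ.toEquiv.subtypeEquiv fun x => by simp

/-- The automorphism `Ψ` of `L` extends the automorphism `φ` of `P` along `f : P → L`. -/
def ExtendsAlong {P L : Type*} [PartialOrder P] [PartialOrder L] (f : P → L)
    (φ : P ≃o P) (Ψ : L ≃o L) : Prop :=
  ∀ x, Ψ (f x) = f (φ x)

/-- The vertex map `f` sends vertices of `|P|` to vertices of `|L|`, and the permutation `Θ` of the
vertices of `|L|` extends the permutation `θ` of the vertices of `|P|` along it. -/
def ExtendsAlongSimplicially {P L : Type*} [PartialOrder P] [BoundedOrder P] [PartialOrder L]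
    [BoundedOrder L] (f : P → L) (θ : Equiv.Perm (ProperPart P))
    (Θ : Equiv.Perm (ProperPart L)) : Prop :=
  ∀ x : ProperPart P, ∃ h : f x ≠ ⊥ ∧ f x ≠ ⊤, (Θ ⟨f x, h⟩ : L) = f (θ x)

namespace CoxeterSystem

variable {B : Type*} {W : Type*} [Group W] {M : CoxeterMatrix B} (cs : CoxeterSystem M W)

/-! ### Absolute order and non-crossing partitions -/

/-- The absolute length: the length with respect to the set of all reflections. -/
noncomputable def absLength (w : W) : ℕ :=
  sInf {k | ∃ L : List W, (∀ t ∈ L, cs.IsReflection t) ∧ L.prod = w ∧ L.length = k}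

theorem exists_absLength (w : W) :
    ∃ L : List W, (∀ t ∈ L, cs.IsReflection t) ∧ L.prod = w ∧ L.length = cs.absLength w := by
  have h : {k | ∃ L : List W, (∀ t ∈ L, cs.IsReflection t) ∧ L.prod = w ∧ L.length = k}.Nonempty := by
    obtain ⟨ω, hω⟩ := cs.wordProd_surjective w
    refine ⟨_, ω.map cs.simple, ?_, hω, rfl⟩
    intro t ht
    obtain ⟨i, -, rfl⟩ := List.mem_map.1 ht
    exact cs.isReflection_simple i
  exact Nat.sInf_mem h

theorem absLength_le {w : W} (L : List W) (hL : ∀ t ∈ L, cs.IsReflection t) (hw : L.prod = w) :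
    cs.absLength w ≤ L.length :=
  Nat.sInf_le ⟨L, hL, hw, rfl⟩

theorem absLength_one : cs.absLength 1 = 0 := by
  simpa using cs.absLength_le (w := 1) [] (by simp) (by simp)

theorem eq_one_of_absLength_eq_zero {w : W} (h : cs.absLength w = 0) : w = 1 := by
  obtain ⟨L, -, h2, h3⟩ := cs.exists_absLength w
  rw [h, List.length_eq_zero_iff] at h3
  subst h3
  simpa using h2.symm

theorem absLength_mul_le (v w : W) :
    cs.absLength (v * w) ≤ cs.absLength v + cs.absLength w := by
  obtain ⟨L, h1, h2, h3⟩ := cs.exists_absLength v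
  obtain ⟨L', h1', h2', h3'⟩ := cs.exists_absLength w
  rw [← h3, ← h3', ← List.length_append]
  refine cs.absLength_le _ ?_ (by rw [List.prod_append, h2, h2'])
  intro t ht
  rcases List.mem_append.1 ht with h | h
  exacts [h1 t h, h1' t h]

theorem absLength_conj (g w : W) : cs.absLength (g * w * g⁻¹) = cs.absLength w := by
  have key : ∀ g w : W, cs.absLength (g * w * g⁻¹) ≤ cs.absLength w := by
    intro g w
    obtain ⟨L, h1, h2, h3⟩ := cs.exists_absLength w
    have := cs.absLength_le (w := g * w * g⁻¹) (L.map (MulAut.conj g)) ?_ ?_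
    · rwa [List.length_map, h3] at this
    · intro t ht
      obtain ⟨u, hu, rfl⟩ := List.mem_map.1 ht
      exact (h1 u hu).conj g
    · rw [← map_list_prod, h2, MulAut.conj_apply]
  refine le_antisymm (key g w) ?_
  have := key g⁻¹ (g * w * g⁻¹)
  rwa [show g⁻¹ * (g * w * g⁻¹) * g⁻¹⁻¹ = w by group] at this

theorem absLength_inv (w : W) : cs.absLength w⁻¹ = cs.absLength w := by
  have key : ∀ w : W, cs.absLength w⁻¹ ≤ cs.absLength w := by
    intro w
    obtain ⟨L, h1, h2, h3⟩ := cs.exists_absLength w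
    have := cs.absLength_le (w := w⁻¹) (L.map (·⁻¹)).reverse ?_ ?_
    · rwa [List.length_reverse, List.length_map, h3] at this
    · intro t ht
      obtain ⟨u, hu, rfl⟩ := List.mem_map.1 (List.mem_reverse.1 ht)
      exact (h1 u hu).isReflection_inv
    · rw [← h2, List.prod_inv_reverse]
  refine le_antisymm (key w) ?_
  simpa using key w⁻¹

/-- The absolute order `v ≤ w` on `W`. -/
def AbsLE (v w : W) : Prop :=
  cs.absLength w = cs.absLength v + cs.absLength (v⁻¹ * w)

theorem AbsLE.inv {v w : W} (h : cs.AbsLE v w) : cs.AbsLE v⁻¹ w⁻¹ := by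
  unfold AbsLE at *
  rw [cs.absLength_inv, cs.absLength_inv, h, ← cs.absLength_inv (v⁻¹⁻¹ * w⁻¹),
    ← cs.absLength_conj v (v⁻¹ * w)]
  congr 2
  group

theorem AbsLE.conj {v w : W} (h : cs.AbsLE v w) (g : W) :
    cs.AbsLE (g * v * g⁻¹) (g * w * g⁻¹) := by
  unfold AbsLE at *
  rw [cs.absLength_conj, cs.absLength_conj, h, ← cs.absLength_conj g (v⁻¹ * w)]
  congr 2
  group

/-- The poset `NC(W, c)` of non-crossing partitions: the elements of `W` below `c` in the
absolute order. -/
@[ext]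
structure NC (c : W) where
  val : W
  absLE : cs.AbsLE val c

theorem absLE_refl (w : W) : cs.AbsLE w w := by
  rw [AbsLE, inv_mul_cancel, absLength_one, add_zero]

theorem one_absLE (w : W) : cs.AbsLE 1 w := by
  rw [AbsLE, absLength_one, inv_one, one_mul, zero_add]

theorem AbsLE.trans {u v w : W} (huv : cs.AbsLE u v) (hvw : cs.AbsLE v w) : cs.AbsLE u w := by
  unfold AbsLE at *
  have h1 := cs.absLength_mul_le (u⁻¹ * v) (v⁻¹ * w)
  have h2 := cs.absLength_mul_le u (u⁻¹ * w)
  rw [show u⁻¹ * v * (v⁻¹ * w) = u⁻¹ * w by group] at h1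
  rw [mul_inv_cancel_left] at h2
  omega

theorem AbsLE.antisymm {v w : W} (hvw : cs.AbsLE v w) (hwv : cs.AbsLE w v) : v = w := by
  unfold AbsLE at *
  have h : cs.absLength (v⁻¹ * w) = 0 := by omega
  exact inv_mul_eq_one.1 (cs.eq_one_of_absLength_eq_zero h)

instance (c : W) : PartialOrder (cs.NC c) where
  le v w := cs.AbsLE v.val w.val
  le_refl v := cs.absLE_refl v.val
  le_trans _ _ _ huv hvw := AbsLE.trans cs huv hvw
  le_antisymm _ _ hvw hwv := NC.ext (AbsLE.antisymm cs hvw hwv)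

instance (c : W) : BoundedOrder (cs.NC c) where
  bot := ⟨1, cs.one_absLE c⟩
  bot_le w := cs.one_absLE w.val
  top := ⟨c, cs.absLE_refl c⟩
  le_top w := w.absLE

/-- A Coxeter element: a conjugate of a product of all simple reflections, each taken once, in
some order. -/
def IsCoxeterElement (c : W) : Prop :=
  ∃ ω : List B, ω.Nodup ∧ (∀ i, i ∈ ω) ∧ IsConj (cs.wordProd ω) c

/-- The irreducibility of the Coxeter system: its Coxeter diagram is connected (in particular
nonempty). -/
def _root_.CoxeterMatrix.IsIrreducible {B : Type*} (M : CoxeterMatrix B) : Prop :=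
  (SimpleGraph.fromRel fun i j : B => M i j ≠ 2).Connected

/-! ### The dihedral group of automorphisms -/

/-- The automorphism `w ↦ a w⁻¹ a` of `NC(W, c)`, where `a` is an involution such that
`a c⁻¹ a = c`. -/
def invConjAut {c : W} (a : W) (ha : a * a = 1) (hc : a * c⁻¹ * a = c) : cs.NC c ≃o cs.NC c :=
  have hinv : a⁻¹ = a := inv_eq_of_mul_eq_one_right ha
  have key : ∀ v w : W, cs.AbsLE v w → cs.AbsLE (a * v⁻¹ * a) (a * w⁻¹ * a) := fun v w h => by
    simpa only [hinv] using AbsLE.conj cs (AbsLE.inv cs h) a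
  have invol : ∀ w : W, a * (a * w⁻¹ * a)⁻¹ * a = w := fun w => by
    simp only [mul_inv_rev, hinv, inv_inv, ← mul_assoc, ha, one_mul]
    rw [mul_assoc, ha, mul_one]
  have mem : ∀ w : cs.NC c, cs.AbsLE (a * w.val⁻¹ * a) c := fun w => by
    simpa only [hc] using key _ _ w.absLE
  { toFun := fun w => ⟨a * w.val⁻¹ * a, mem w⟩
    invFun := fun w => ⟨a * w.val⁻¹ * a, mem w⟩
    left_inv := fun w => NC.ext (invol w.val)
    right_inv := fun w => NC.ext (invol w.val)
    map_rel_iff' := fun {v w} => by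
      refine ⟨fun h => ?_, fun h => key _ _ h⟩
      have := key _ _ h
      rwa [Equiv.coe_fn_mk, invol, invol] at this }

/-- `c = l r` is a bipartition of `c`: both `l` and `r` square to the identity. -/
structure IsBipartition (c l r : W) : Prop where
  eq_mul : c = l * r
  left_sq : l * l = 1
  right_sq : r * r = 1

/-- The automorphism `φ_l : w ↦ l w⁻¹ l`. -/
def leftAut {c l r : W} (h : IsBipartition c l r) : cs.NC c ≃o cs.NC c :=
  cs.invConjAut l h.left_sq (by
    rw [h.eq_mul, mul_inv_rev, inv_eq_of_mul_eq_one_right h.left_sq,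
      inv_eq_of_mul_eq_one_right h.right_sq, mul_assoc, mul_assoc, h.left_sq, mul_one])

/-- The automorphism `φ_r : w ↦ r w⁻¹ r`. -/
def rightAut {c l r : W} (h : IsBipartition c l r) : cs.NC c ≃o cs.NC c :=
  cs.invConjAut r h.right_sq (by
    rw [h.eq_mul, mul_inv_rev, inv_eq_of_mul_eq_one_right h.left_sq,
      inv_eq_of_mul_eq_one_right h.right_sq, ← mul_assoc, h.right_sq, one_mul])

/-- The dihedral group `⟨φ_l, φ_r⟩` of automorphisms of `NC(W, c)`. -/
def dihedralAut {c l r : W} (h : IsBipartition c l r) : Subgroup (cs.NC c ≃o cs.NC c) :=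
  Subgroup.closure {cs.leftAut h, cs.rightAut h}

/-! ### The geometric representation, roots and moved spaces -/

section Geometric

variable [Fintype B] [DecidableEq B]

/-- The bilinear form on the space `B → ℝ`, whose standard basis vectors are the simple roots,
when the simple root `α_i` is given the length `c i`:
`(α_i, α_j) = - c_i c_j cos (π / m_ij)`. -/
noncomputable def _root_.CoxeterMatrix.rootForm (M : CoxeterMatrix B) (c : B → Set.Ioi (0 : ℝ)) :
    LinearMap.BilinForm ℝ (B → ℝ) :=
  Matrix.toBilin' (Matrix.of fun i j => -((c i : ℝ) * c j * Real.cos (Real.pi / M i j)))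

/-- The simple roots. -/
def simpleRoot (i : B) : B → ℝ := Pi.single i 1

theorem rootForm_simpleRoot (c : B → Set.Ioi (0 : ℝ)) (i j : B) :
    M.rootForm c (simpleRoot i) (simpleRoot j) = -((c i : ℝ) * c j * Real.cos (Real.pi / M i j)) := by
  simp [CoxeterMatrix.rootForm, simpleRoot, Matrix.toBilin'_single]

theorem rootForm_simpleRoot_self (c : B → Set.Ioi (0 : ℝ)) (i : B) :
    M.rootForm c (simpleRoot i) (simpleRoot i) = (c i : ℝ) ^ 2 := by
  rw [rootForm_simpleRoot, M.diagonal]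
  simp [sq]

/-- The functional `v ↦ 2 (α_i, v) / (α_i, α_i)`. -/
noncomputable def _root_.CoxeterMatrix.simpleCoroot (M : CoxeterMatrix B)
    (c : B → Set.Ioi (0 : ℝ)) (i : B) : Module.Dual ℝ (B → ℝ) :=
  (2 / M.rootForm c (simpleRoot i) (simpleRoot i)) • M.rootForm c (simpleRoot i)

theorem simpleCoroot_simpleRoot (c : B → Set.Ioi (0 : ℝ)) (i j : B) :
    M.simpleCoroot c i (simpleRoot j) = -(2 * (c j / c i) * Real.cos (Real.pi / M i j)) := by
  have hi : (c i : ℝ) ≠ 0 := (c i).2.ne'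
  rw [CoxeterMatrix.simpleCoroot, LinearMap.smul_apply, rootForm_simpleRoot_self,
    rootForm_simpleRoot, smul_eq_mul]
  field_simp

theorem simpleCoroot_self (c : B → Set.Ioi (0 : ℝ)) (i : B) :
    M.simpleCoroot c i (simpleRoot i) = 2 := by
  have hi : (c i : ℝ) ≠ 0 := (c i).2.ne'
  rw [simpleCoroot_simpleRoot, M.diagonal, div_self hi]
  simp

/-- The reflection `v ↦ v - 2 (α_i, v) / (α_i, α_i) α_i`. -/
noncomputable def _root_.CoxeterMatrix.simpleReflection (M : CoxeterMatrix B)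
    (c : B → Set.Ioi (0 : ℝ)) (i : B) : (B → ℝ) ≃ₗ[ℝ] (B → ℝ) :=
  Module.reflection (simpleCoroot_self (M := M) c i)

theorem isLiftable_simpleReflection (c : B → Set.Ioi (0 : ℝ)) :
    M.IsLiftable (M.simpleReflection c) := by
  intro i j
  have hi : (c i : ℝ) ≠ 0 := (c i).2.ne'
  have hj : (c j : ℝ) ≠ 0 := (c j).2.ne'
  rcases eq_or_ne i j with rfl | hij
  · rw [M.diagonal, pow_one]
    ext v : 1
    exact Module.involutive_reflection (simpleCoroot_self (M := M) c i) v
  rcases Nat.eq_zero_or_pos (M i j) with h0 | hpos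
  · rw [h0, pow_zero]
  have h1 : M i j ≠ 1 := M.off_diagonal i j hij
  set m := M i j with hm
  set θ := Real.pi / m with hθ
  have hmθ : (m : ℝ) * θ = Real.pi := by rw [hθ]; field_simp
  have hgx : M.simpleCoroot c j (simpleRoot i) = -(2 * (c i / c j) * Real.cos θ) := by
    rw [simpleCoroot_simpleRoot, M.symmetric j i]
  have hfy : M.simpleCoroot c i (simpleRoot j) = -(2 * (c j / c i) * Real.cos θ) := by
    rw [simpleCoroot_simpleRoot]
  have ht : 2 * Real.cos (2 * θ)
      = M.simpleCoroot c i (simpleRoot j) * M.simpleCoroot c j (simpleRoot i) - 2 := by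
    rw [hgx, hfy, Real.cos_two_mul]
    field_simp
  ext v : 1
  change ((Module.reflection (simpleCoroot_self (M := M) c i) *
    Module.reflection (simpleCoroot_self (M := M) c j)) ^ m) v = v
  rcases eq_or_ne m 2 with h2 | h2
  · have hc0 : Real.cos θ = 0 := by rw [hθ, h2]; simp
    rw [hc0] at hgx hfy
    simp only [mul_zero, neg_zero] at hgx hfy
    rw [h2, sq]
    simp only [LinearEquiv.mul_apply, Module.reflection_apply, map_sub, map_smul, hgx, hfy,
      simpleCoroot_self]
    module
  have hsin : Real.sin (2 * θ) ≠ 0 := by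
    have hm3 : 3 ≤ m := by omega
    have hm3' : (3 : ℝ) ≤ m := by exact_mod_cast hm3
    have hθpos : 0 < θ := div_pos Real.pi_pos (by positivity)
    refine (Real.sin_pos_of_pos_of_lt_pi (by positivity) ?_).ne'
    nlinarith
  have hS : ∀ n : ℤ, (Polynomial.Chebyshev.S ℝ n).eval (2 * Real.cos (2 * θ))
      = Real.sin ((n + 1) * (2 * θ)) / Real.sin (2 * θ) := fun n => by
    rw [eq_div_iff hsin, Polynomial.Chebyshev.S_two_mul_real_cos]
  rw [Module.reflection_mul_reflection_pow_apply _ _ m v _ ht]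
  rcases Nat.even_or_odd' m with ⟨k, hk | hk⟩
  · have e1 : ((m : ℤ) - 2) / 2 = k - 1 := by omega
    have e2 : ((m : ℤ) - 1) / 2 = k - 1 := by omega
    have hz : (Polynomial.Chebyshev.S ℝ ((k : ℤ) - 1)).eval (2 * Real.cos (2 * θ)) = 0 := by
      rw [hS]
      have : (((k : ℤ) - 1 : ℤ) + 1 : ℝ) * (2 * θ) = Real.pi := by
        rw [← hmθ, hk]; push_cast; ring
      rw [this]; simp
    rw [e1, e2, hz]
    simp
  · have e1 : ((m : ℤ) - 2) / 2 = k - 1 := by omega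
    have e2 : ((m : ℤ) - 1) / 2 = k := by omega
    have e3 : ((m : ℤ) - 3) / 2 = k - 1 := by omega
    have e4 : (m : ℤ) / 2 = k := by omega
    have hz : (Polynomial.Chebyshev.S ℝ (k : ℤ)).eval (2 * Real.cos (2 * θ))
        + (Polynomial.Chebyshev.S ℝ ((k : ℤ) - 1)).eval (2 * Real.cos (2 * θ)) = 0 := by
      rw [hS, hS, ← add_div]
      have a1 : (((k : ℤ) : ℝ) + 1) * (2 * θ) = Real.pi + θ := by
        rw [← hmθ, hk]; push_cast; ring
      have a2 : (((k : ℤ) - 1 : ℤ) + 1 : ℝ) * (2 * θ) = Real.pi - θ := by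
        rw [← hmθ, hk]; push_cast; ring
      rw [a1, a2, Real.sin_pi_sub, add_comm Real.pi θ, Real.sin_add_pi]
      simp
    rw [e1, e2, e3, e4, hz]
    simp

/-- The geometric representation of `W` on `B → ℝ`, where the simple root `α_i` is given the
length `c i`; the simple reflection `s_i` acts by `v ↦ v - 2 (α_i, v) / (α_i, α_i) α_i`. -/
noncomputable def geomRep (c : B → Set.Ioi (0 : ℝ)) : W →* ((B → ℝ) ≃ₗ[ℝ] (B → ℝ)) :=
  cs.lift ⟨M.simpleReflection c, isLiftable_simpleReflection c⟩

/-- The choice of lengths for which all roots have length one. -/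
def unitLengths : B → Set.Ioi (0 : ℝ) := fun _ => ⟨1, Set.mem_Ioi.2 zero_lt_one⟩

/-- The vector `α` is one of the two roots whose reflection is `t`:
`α = w(α_i)` and `t = w s_i w⁻¹` for some `w` and `i`. -/
def IsRootOf (c : B → Set.Ioi (0 : ℝ)) (t : W) (α : B → ℝ) : Prop :=
  ∃ w i, t = w * cs.simple i * w⁻¹ ∧ α = cs.geomRep c w (simpleRoot i)

/-- The root system: the orbit of the simple roots. -/
def roots (c : B → Set.Ioi (0 : ℝ)) : Set (B → ℝ) :=
  {α | ∃ w i, α = cs.geomRep c w (simpleRoot i)}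

/-- The positive roots: those with nonnegative coordinates with respect to the simple roots. -/
def posRoots (c : B → Set.Ioi (0 : ℝ)) : Set (B → ℝ) :=
  {α ∈ cs.roots c | ∀ i, 0 ≤ α i}

/-- The moved space of `w`: the image of `w - id`. -/
noncomputable def moved (c : B → Set.Ioi (0 : ℝ)) (w : W) : Submodule ℝ (B → ℝ) :=
  LinearMap.range ((cs.geomRep c w : (B → ℝ) →ₗ[ℝ] (B → ℝ)) - LinearMap.id)

/-! ### Crystallographic root systems and reduction modulo a prime -/

/-- With the lengths `c`, the roots form a (reduced) crystallographic root system. -/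
structure IsCrystallographic (c : B → Set.Ioi (0 : ℝ)) : Prop where
  reduced : ∀ α ∈ cs.roots c, ∀ k : ℝ, k • α ∈ cs.roots c → k = 1 ∨ k = -1
  integral : ∀ α ∈ cs.roots c, ∀ β ∈ cs.roots c,
    ∃ n : ℤ, 2 * M.rootForm c α β / M.rootForm c β β = n

/-- The inclusion of the lattice `V_ℤ` spanned by the simple roots. -/
def intVec : (B → ℤ) →+ (B → ℝ) := (Int.castAddHom ℝ).compLeft B

/-- The reduction map from `V_ℤ` to the `𝔽_p`-vector space on the simple roots. -/
def reduceMod (p : ℕ) : (B → ℤ) →+ (B → ZMod p) := (Int.castAddHom (ZMod p)).compLeft B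

/-- The prime `p` is compatible with the root system: each basis of `V` consisting of positive
roots (which are integer vectors) is reduced modulo `p` to a basis. -/
def IsCompatible (c : B → Set.Ioi (0 : ℝ)) (p : ℕ) : Prop :=
  ∀ b : B → (B → ℤ), (∀ i, intVec (b i) ∈ cs.posRoots c) →
    LinearIndependent ℝ (fun i => intVec (b i)) →
    Submodule.span ℝ (Set.range fun i => intVec (b i)) = ⊤ →
    LinearIndependent (ZMod p) (fun i => reduceMod p (b i)) ∧
      Submodule.span (ZMod p) (Set.range fun i => reduceMod p (b i)) = ⊤

/-- The integral moved space: the integer vectors in the moved space. -/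
noncomputable def intMoved (c : B → Set.Ioi (0 : ℝ)) (w : W) : AddSubgroup (B → ℤ) :=
  (cs.moved c w).toAddSubgroup.comap intVec

/-- The `p`-moved space: the reduction modulo `p` of the integral moved space. -/
noncomputable def modMoved (c : B → Set.Ioi (0 : ℝ)) (p : ℕ) (w : W) :
    Submodule (ZMod p) (B → ZMod p) :=
  AddSubgroup.toZModSubmodule p ((cs.intMoved c w).map (reduceMod p))

/-- The vector `a` over `𝔽_p` is the reduction of one of the two roots whose reflection is `t`. -/
def IsModRootOf (c : B → Set.Ioi (0 : ℝ)) (p : ℕ) (t : W) (a : B → ZMod p) : Prop :=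
  ∃ α : B → ℤ, cs.IsRootOf c t (intVec α) ∧ a = reduceMod p α

end Geometric

/-! ### Unique extension of an automorphism of the non-crossing partitions -/

section Extension

variable {K V : Type*} [Field K] [AddCommGroup V] [Module K V]

/-- The automorphism of the lattice of subspaces induced by a linear automorphism. -/
def inducedAut (ψ : V ≃ₗ[K] V) : Submodule K V ≃o Submodule K V :=
  Submodule.orderIsoMapComap ψ

/-- The type-preserving simplicial automorphisms of the building `|Λ(V)|`; the type of a vertex is
the dimension of the subspace. -/
noncomputable def buildingAut (K V : Type*) [Field K] [AddCommGroup V] [Module K V] :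
    Subgroup (Equiv.Perm (ProperPart (Submodule K V))) :=
  typePreservingAut (orderComplex (Submodule K V)) fun U => Module.finrank K U.1

/-- The type-preserving simplicial automorphisms of the complex `|NC(W, c)|`; the type of a vertex
is its rank, that is, its absolute length. -/
noncomputable def complexAut (c : W) : Subgroup (Equiv.Perm (ProperPart (cs.NC c))) :=
  typePreservingAut (orderComplex (cs.NC c)) fun w => cs.absLength w.1.val

/-- The automorphism `φ` of `NC(W, c)` extends along `f : NC(W, c) → Λ(V)`, and in which sense the
extension is unique; `IsRoot t` holds for the roots (over `K`) belonging to the reflection `t`. -/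
structure ExtendsUniquely {c : W} (f : cs.NC c → Submodule K V) (IsRoot : W → V → Prop)
    (φ : cs.NC c ≃o cs.NC c) : Prop where
  /-- The induced vertex map of `|NC(W, c)|` is a type-preserving simplicial automorphism. -/
  properPerm_mem : properPerm φ ∈ cs.complexAut c
  exists_unique : ∃ ψ : V ≃ₗ[K] V,
    -- the linear map sends `α_t` to `± α_{φ(t)}` for all reflections `t`
    (∀ t : cs.NC c, cs.IsReflection t.val → ∀ α β, IsRoot t.val α → IsRoot (φ t).val β →
      ψ α = β ∨ ψ α = -β) ∧
    -- the automorphism of `Λ(V)` induced by it extends `φ`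
    ExtendsAlong f φ (inducedAut ψ) ∧
    -- the induced automorphism of the building extends the one of the complex
    properPerm (inducedAut ψ) ∈ buildingAut K V ∧
    ExtendsAlongSimplicially f (properPerm φ) (properPerm (inducedAut ψ)) ∧
    -- in the irreducible case it is the only linearly induced extension
    (M.IsIrreducible → ∀ ψ' : V ≃ₗ[K] V, ExtendsAlong f φ (inducedAut ψ') →
      inducedAut ψ' = inducedAut ψ) ∧
    -- in the irreducible case of rank different from two it is the only extension
    (M.IsIrreducible → Module.finrank K V ≠ 2 →
      (∀ Ψ : Submodule K V ≃o Submodule K V, ExtendsAlong f φ Ψ → Ψ = inducedAut ψ) ∧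
      (∀ Θ ∈ buildingAut K V, ExtendsAlongSimplicially f (properPerm φ) Θ →
        Θ = properPerm (inducedAut ψ)))

end Extension

end CoxeterSystem

/-!
Conjugation by `g` acts on moved spaces through the linear representation,
`mov (g w g⁻¹) = g (mov w)`, while inversion fixes them, `mov w⁻¹ = mov w`. Hence every automorphism
of `NC` of the form `w ↦ g w g⁻¹` or `w ↦ g w⁻¹ g⁻¹` is extended by the action of `g` on the
subspaces. The simple reflections of a crystallographic root system preserve the integer vectors, so
all of this survives reduction modulo `p`.

For uniqueness, write `c` as `k (s₁ ⋯ sₙ) k⁻¹`. Below `c` lie the reflections `k sᵢ k⁻¹`, whose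
moved spaces are the axes of a basis, and the reflections `k sᵢ sⱼ sᵢ k⁻¹` for `i` before `j`, whose
moved spaces are lines in the coordinate planes, distinct from the axes whenever `i` and `j` are
joined in the Coxeter diagram. A linear map fixing all these lines is a scalar if the diagram is
connected. A lattice automorphism fixing them is trivial too in dimension other than two, by the
argument of the fundamental theorem of projective geometry, since `ℝ` and `𝔽ₚ` have no nontrivial
field endomorphisms. Modulo `p` the lines stay distinct from the axes for every `p` because one of
the two Cartan integers of a bond is `-1`.
-/

namespace NoncrossingPartitions

open CoxeterSystem

/-! ### Automorphisms of the lattice of subspaces -/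

section SubspaceLattice

variable {ι K V : Type*} [Field K] [AddCommGroup V] [Module K V]

theorem inducedAut_apply (χ : V ≃ₗ[K] V) (U : Submodule K V) :
    inducedAut χ U = U.map (χ : V →ₗ[K] V) :=
  rfl

theorem inducedAut_span_singleton (χ : V ≃ₗ[K] V) (v : V) :
    inducedAut χ (K ∙ v) = K ∙ χ v := by
  rw [inducedAut_apply, Submodule.map_span, Set.image_singleton, LinearEquiv.coe_coe]

theorem inducedAut_mul (χ χ' : V ≃ₗ[K] V) :
    inducedAut (χ * χ') = inducedAut χ * inducedAut χ' :=
  RelIso.ext fun U : Submodule K V => Submodule.map_comp (χ' : V →ₗ[K] V) (χ : V →ₗ[K] V) U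

theorem inducedAut_one : inducedAut (1 : V ≃ₗ[K] V) = 1 :=
  RelIso.ext fun U : Submodule K V => Submodule.map_id U

theorem inducedAut_inv (χ : V ≃ₗ[K] V) : inducedAut χ⁻¹ = (inducedAut χ)⁻¹ := by
  rw [eq_inv_iff_mul_eq_one, ← inducedAut_mul, inv_mul_cancel, inducedAut_one]

theorem submoduleAut_eq_one_of_span_singleton {Ψ : Submodule K V ≃o Submodule K V}
    (h : ∀ v : V, Ψ (K ∙ v) = K ∙ v) : Ψ = 1 := by
  refine RelIso.ext fun U => ?_
  have hU : U = ⨆ v ∈ U, (K ∙ v) := by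
    simpa only [Submodule.span_eq, SetLike.mem_coe] using
      Submodule.span_eq_iSup_of_singleton_spans (R := K) (U : Set V)
  calc Ψ U = ⨆ v ∈ U, Ψ (K ∙ v) := by conv_lhs => rw [hU]; simp only [OrderIso.map_iSup]
    _ = U := by simp only [h, ← hU]

theorem exists_orderIso_span_singleton_eq (Ψ : Submodule K V ≃o Submodule K V) {v : V}
    (hv : v ≠ 0) : ∃ u, u ≠ 0 ∧ Ψ (K ∙ v) = K ∙ u :=
  (atom_iff_nonzero_span _).1 ((Ψ.isAtom_iff _).2 (nonzero_span_atom v hv))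

theorem ker_coord_eq_iSup_span (b : Module.Basis ι K V) (k : ι) :
    LinearMap.ker (b.coord k) = ⨆ j : {j // j ≠ k}, K ∙ b j := by
  classical
  apply le_antisymm
  · intro v hv
    rw [← b.linearCombination_repr v, Finsupp.linearCombination_apply]
    refine Submodule.sum_mem _ fun j hj => Submodule.smul_mem _ _ ?_
    have hjk : j ≠ k := fun hjk => Finsupp.mem_support_iff.1 hj (hjk ▸ hv)
    exact Submodule.mem_iSup_of_mem ⟨j, hjk⟩ (Submodule.mem_span_singleton_self _)
  · refine iSup_le fun j => (Submodule.span_singleton_le_iff_mem _ _).2 ?_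
    rw [LinearMap.mem_ker, b.coord_apply, b.repr_self_apply, if_neg j.2]

theorem span_sub_basis_eq {b : Module.Basis ι K V} {o : ι} {w : V} (hw : b.repr w o = 1) :
    K ∙ (w - b o) = ((K ∙ w) ⊔ (K ∙ b o)) ⊓ LinearMap.ker (b.coord o) := by
  apply le_antisymm
  · rw [Submodule.span_singleton_le_iff_mem]
    refine ⟨Submodule.sub_mem_sup (Submodule.mem_span_singleton_self w)
      (Submodule.mem_span_singleton_self _), ?_⟩
    simp [hw]
  · rintro _ ⟨hx, hxo⟩
    obtain ⟨_, hy, _, hz, rfl⟩ := Submodule.mem_sup.1 hx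
    obtain ⟨y, rfl⟩ := Submodule.mem_span_singleton.1 hy
    obtain ⟨z, rfl⟩ := Submodule.mem_span_singleton.1 hz
    have hyz : y + z = 0 := by simpa [hw] using hxo
    rw [eq_neg_of_add_eq_zero_right hyz, neg_smul, ← sub_eq_add_neg, ← smul_sub]
    exact Submodule.smul_mem _ _ (Submodule.mem_span_singleton_self _)

section FixedAxes

variable {b : Module.Basis ι K V} {Ψ : Submodule K V ≃o Submodule K V}
  (hΨ : ∀ i, Ψ (K ∙ b i) = K ∙ b i)

include hΨ

theorem map_ker_coord_of_fixes_axes (k : ι) :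
    Ψ (LinearMap.ker (b.coord k)) = LinearMap.ker (b.coord k) := by
  simp only [ker_coord_eq_iSup_span, OrderIso.map_iSup, hΨ]

theorem repr_eq_zero_iff_of_fixes_axes {u v : V} (huv : Ψ (K ∙ v) = K ∙ u) (k : ι) :
    b.repr u k = 0 ↔ b.repr v k = 0 := by
  simp only [← b.coord_apply, ← LinearMap.mem_ker, ← Submodule.span_singleton_le_iff_mem]
  rw [← huv, ← Ψ.le_iff_le (x := K ∙ v), map_ker_coord_of_fixes_axes hΨ]

theorem exists_normalized_image_of_fixes_axes {v : V} {o : ι} (hv : b.repr v o = 1) :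
    ∃ u, b.repr u o = 1 ∧ Ψ (K ∙ v) = K ∙ u := by
  have hv0 : v ≠ 0 := by rintro rfl; simp at hv
  obtain ⟨u, -, hu⟩ := exists_orderIso_span_singleton_eq Ψ hv0
  have huo : b.repr u o ≠ 0 := by
    rw [ne_eq, repr_eq_zero_iff_of_fixes_axes hΨ hu, hv]
    exact one_ne_zero
  refine ⟨(b.repr u o)⁻¹ • u, ?_, ?_⟩
  · rw [map_smul, Finsupp.smul_apply, smul_eq_mul, inv_mul_cancel₀ huo]
  · rw [hu, Submodule.span_singleton_smul_eq (inv_ne_zero huo).isUnit]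

theorem repr_image_eq_of_repr_eq {v v' u u' : V} {o j : ι}
    (hv : b.repr v o = 1) (hv' : b.repr v' o = 1) (hu : b.repr u o = 1) (hu' : b.repr u' o = 1)
    (huv : Ψ (K ∙ v) = K ∙ u) (huv' : Ψ (K ∙ v') = K ∙ u') (h : b.repr v j = b.repr v' j) :
    b.repr u j = b.repr u' j := by
  set H := LinearMap.ker (b.coord o) ⊓ LinearMap.ker (b.coord j)
  have hvH : K ∙ v ≤ (K ∙ v') ⊔ H := by
    rw [Submodule.span_singleton_le_iff_mem]
    refine Submodule.mem_sup.2
      ⟨v', Submodule.mem_span_singleton_self v', v - v', ⟨?_, ?_⟩, add_sub_cancel v' v⟩ <;>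
    simp [hv, hv', h]
  have huH : u ∈ (K ∙ u') ⊔ H := by
    rw [← Submodule.span_singleton_le_iff_mem, ← huv, ← huv']
    simpa only [map_sup, map_inf, H, map_ker_coord_of_fixes_axes hΨ] using Ψ.monotone hvH
  obtain ⟨_, hx, w, ⟨hwo, hwj⟩, rfl⟩ := Submodule.mem_sup.1 huH
  obtain ⟨x, rfl⟩ := Submodule.mem_span_singleton.1 hx
  replace hwo : b.repr w o = 0 := hwo
  replace hwj : b.repr w j = 0 := hwj
  have hx1 : x = 1 := by simpa [hu', hwo] using hu
  simp [hx1, hwj]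

end FixedAxes

/-- The automorphism `Ψ` of the lattice of subspaces maps the line through `v` to the line through
the vector with coordinates `τ j (v j)`, provided that `v` is normalized at `o`, that is, its
coordinate at `o` is `0` or `1`. -/
def ActsCoordinatewise (b : Module.Basis ι K V) (o : ι) (τ : ι → K → K)
    (Ψ : Submodule K V ≃o Submodule K V) : Prop :=
  ∀ v, b.repr v o = 0 ∨ b.repr v o = 1 →
    ∃ u, (∀ j, b.repr u j = τ j (b.repr v j)) ∧ Ψ (K ∙ v) = K ∙ u

theorem exists_actsCoordinatewise {b : Module.Basis ι K V} {Ψ : Submodule K V ≃o Submodule K V}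
    (hΨ : ∀ i, Ψ (K ∙ b i) = K ∙ b i) (o : ι) :
    ∃ τ : ι → K → K, τ o = id ∧ ActsCoordinatewise b o τ Ψ := by
  classical
  choose! u hu hΨu using fun v (hv : b.repr v o = 1) =>
    exists_normalized_image_of_fixes_axes hΨ hv
  let τ : ι → K → K := fun j x => if j = o then x else b.repr (u (b o + x • b j)) j
  have hτ : ∀ v, b.repr v o = 1 → ∀ j, b.repr (u v) j = τ j (b.repr v j) := by
    intro v hv j
    by_cases hj : j = o
    · simp only [τ, hj, if_pos, hv, hu]
    have hvj : b.repr (b o + b.repr v j • b j) o = 1 := by simp [hj]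
    simp only [τ, if_neg hj]
    exact repr_image_eq_of_repr_eq hΨ hv hvj (hu v hv) (hu _ hvj) (hΨu v hv) (hΨu _ hvj)
      (by simp [Ne.symm hj])
  refine ⟨τ, by simp [τ, funext_iff], fun v hv => ?_⟩
  rcases hv with hv | hv
  · have hov : b.repr (b o + v) o = 1 := by simp [hv]
    refine ⟨u (b o + v) - b o, fun j => ?_, ?_⟩
    · by_cases hj : j = o
      · simp [hj, hu _ hov, τ, hv]
      · simp [hτ _ hov, Ne.symm hj]
    rw [span_sub_basis_eq (hu _ hov), ← hΨu _ hov]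
    conv_rhs => rw [← map_ker_coord_of_fixes_axes hΨ, ← hΨ o, ← map_sup, ← map_inf]
    rw [← span_sub_basis_eq hov, add_sub_cancel_left]
  · exact ⟨u v, hτ v hv, hΨu v hv⟩

namespace ActsCoordinatewise

variable {b : Module.Basis ι K V} {o : ι} {τ : ι → K → K} {Ψ : Submodule K V ≃o Submodule K V}

theorem apply_zero (h : ActsCoordinatewise b o τ Ψ) (j : ι) : τ j 0 = 0 := by
  obtain ⟨u, hu, hΨu⟩ := h 0 (by simp)
  have hu0 : u = 0 := by simpa using hΨu.symm
  simpa [hu0] using (hu j).symm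

theorem apply_one (h : ActsCoordinatewise b o τ Ψ) (ho : τ o 1 = 1) {j : ι} (hj : j ≠ o)
    (hframe : Ψ (K ∙ (b o + b j)) = K ∙ (b o + b j)) : τ j 1 = 1 := by
  classical
  obtain ⟨u, hu, hΨu⟩ := h (b o + b j) (by simp [hj])
  have huj : u ∈ K ∙ (b o + b j) := by
    rw [← hframe, hΨu]
    exact Submodule.mem_span_singleton_self u
  obtain ⟨x, rfl⟩ := Submodule.mem_span_singleton.1 huj
  have hx : x = 1 := by simpa [hj, ho] using hu o
  simpa [hj.symm, hx] using (hu j).symm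

theorem apply_mul (h : ActsCoordinatewise b o τ Ψ) {j k : ι} (hj : j ≠ o) (hk : k ≠ o)
    (hjk : j ≠ k) (hτj : τ j 1 = 1) (x y : K) : τ k (x * y) = τ j x * τ k y := by
  classical
  obtain ⟨u, hu, hΨu⟩ := h (x • b j + (x * y) • b k) (by simp [hj, hk])
  obtain ⟨w, hw, hΨw⟩ := h (b j + y • b k) (by simp [hj, hk])
  have huw : u ∈ K ∙ w := by
    rw [← Submodule.span_singleton_le_iff_mem, ← hΨu, ← hΨw, mul_smul, ← smul_add]
    exact Ψ.monotone (Submodule.span_singleton_smul_le K x _)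
  obtain ⟨z, rfl⟩ := Submodule.mem_span_singleton.1 huw
  have hz : z = τ j x := by simpa [hjk, hjk.symm, hw, hτj] using hu j
  simpa [hjk, hjk.symm, hw, hz] using (hu k).symm

theorem apply_add (h : ActsCoordinatewise b o τ Ψ) {j k : ι} (hj : j ≠ o) (hk : k ≠ o)
    (hjk : j ≠ k) (hτo : τ o 1 = 1) (hτk : τ k 1 = 1) (x y : K) :
    τ j (x + y) = τ j x + τ j y := by
  classical
  obtain ⟨u, hu, hΨu⟩ := h (b o + (x + y) • b j + b k) (by simp [hj, hk])
  obtain ⟨v, hv, hΨv⟩ := h (b o + x • b j) (by simp [hj])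
  obtain ⟨w, hw, hΨw⟩ := h (y • b j + b k) (by simp [hj, hk])
  have huvw : u ∈ (K ∙ v) ⊔ (K ∙ w) := by
    rw [← Submodule.span_singleton_le_iff_mem, ← hΨu, ← hΨv, ← hΨw, ← map_sup]
    refine Ψ.monotone ((Submodule.span_singleton_le_iff_mem _ _).2 ?_)
    rw [add_smul, ← add_assoc, add_assoc (b o + x • b j)]
    exact Submodule.add_mem_sup (Submodule.mem_span_singleton_self _)
      (Submodule.mem_span_singleton_self _)
  obtain ⟨_, hx, _, hy, rfl⟩ := Submodule.mem_sup.1 huvw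
  obtain ⟨s, rfl⟩ := Submodule.mem_span_singleton.1 hx
  obtain ⟨t, rfl⟩ := Submodule.mem_span_singleton.1 hy
  have hs : s = 1 := by simpa [hj, hk, hv, hw, hτo, h.apply_zero] using hu o
  have ht : t = 1 := by
    simpa [hj, hk, hk.symm, hjk, hv, hw, hτk, h.apply_zero] using hu k
  simpa [hj, hj.symm, hk, hk.symm, hjk, hjk.symm, hv, hw, hs, ht] using (hu j).symm

end ActsCoordinatewise

theorem submoduleAut_eq_one_of_fixes_frame [Subsingleton (K →+* K)] (b : Module.Basis ι K V)
    (hι : Nat.card ι ≠ 2) {Ψ : Submodule K V ≃o Submodule K V}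
    (hΨ : ∀ i, Ψ (K ∙ b i) = K ∙ b i) (o : ι)
    (hframe : ∀ j, j ≠ o → Ψ (K ∙ (b o + b j)) = K ∙ (b o + b j)) : Ψ = 1 := by
  obtain ⟨τ, hτo, hτ⟩ := exists_actsCoordinatewise hΨ o
  have hτo1 : τ o 1 = 1 := by rw [hτo, id]
  have hτ1 : ∀ j, j ≠ o → τ j 1 = 1 := fun j hj => hτ.apply_one hτo1 hj (hframe j hj)
  have hτ_id : ∀ j x, τ j x = x := by
    intro j x
    by_cases hj : j = o
    · rw [hj, hτo, id]
    obtain ⟨k, hkj, hko⟩ : ∃ k, k ≠ j ∧ k ≠ o := by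
      by_contra! hk
      refine hι (Nat.card_eq_two_iff.2 ⟨j, o, hj, Set.eq_univ_of_forall fun k => ?_⟩)
      exact or_iff_not_imp_left.2 (hk k)
    have hkj_eq : ∀ x, τ k x = τ j x := fun x => by
      simpa [hτ1 k hko] using hτ.apply_mul hj hko hkj.symm (hτ1 j hj) x 1
    let θ : K →+* K :=
      { toFun := τ j
        map_one' := hτ1 j hj
        map_mul' := fun x y => by
          rw [hτ.apply_mul hko hj hkj (hτ1 k hko), hkj_eq]
        map_zero' := hτ.apply_zero j
        map_add' := hτ.apply_add hj hko hkj.symm hτo1 (hτ1 k hko) }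
    exact DFunLike.congr_fun (Subsingleton.elim θ (RingHom.id K)) x
  have fixed_of_normalized : ∀ v, b.repr v o = 0 ∨ b.repr v o = 1 → Ψ (K ∙ v) = K ∙ v := by
    intro v hv
    obtain ⟨u, hu, hΨu⟩ := hτ v hv
    rw [hΨu, b.ext_elem fun j => (hu j).trans (hτ_id j _)]
  refine submoduleAut_eq_one_of_span_singleton fun v => ?_
  by_cases hv : b.repr v o = 0
  · exact fixed_of_normalized v (Or.inl hv)
  · have hv' : b.repr ((b.repr v o)⁻¹ • v) o = 1 := by simp [hv]
    simpa only [Submodule.span_singleton_smul_eq (inv_ne_zero hv).isUnit] using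
      fixed_of_normalized _ (Or.inr hv')

theorem exists_scaling_of_fixes_axes {b : Module.Basis ι K V} {Ψ : Submodule K V ≃o Submodule K V}
    (hΨ : ∀ i, Ψ (K ∙ b i) = K ∙ b i) {o j : ι} (hj : j ≠ o) :
    ∃ a : Kˣ, Ψ (K ∙ (b o + b j)) = K ∙ (b o + (a : K) • b j) := by
  classical
  obtain ⟨u, huo, hu⟩ :=
    exists_normalized_image_of_fixes_axes hΨ (v := b o + b j) (o := o) (by simp [hj])
  have huj : b.repr u j ≠ 0 := by
    rw [ne_eq, repr_eq_zero_iff_of_fixes_axes hΨ hu]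
    simp [hj.symm]
  refine ⟨Units.mk0 _ huj, hu.trans (congrArg (K ∙ ·) (b.ext_elem fun k => ?_))⟩
  rcases eq_or_ne k o with rfl | hko
  · simp [huo, hj]
  rcases eq_or_ne k j with rfl | hkj
  · simp [hj.symm]
  · have huk : b.repr u k = 0 := by
      rw [repr_eq_zero_iff_of_fixes_axes hΨ hu]
      simp [hko.symm, hkj.symm]
    simp [huk, hko.symm, hkj.symm]

/- This is the fundamental theorem of projective geometry for a field without endomorphisms: after
rescaling the basis, the automorphism fixes a projective frame. -/
theorem exists_eq_inducedAut_of_fixes_axes [Subsingleton (K →+* K)] (b : Module.Basis ι K V)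
    (hι : Nat.card ι ≠ 2) {Ψ : Submodule K V ≃o Submodule K V}
    (hΨ : ∀ i, Ψ (K ∙ b i) = K ∙ b i) : ∃ χ : V ≃ₗ[K] V, Ψ = inducedAut χ := by
  classical
  rcases isEmpty_or_nonempty ι with hempty | ⟨⟨o⟩⟩
  · have : Subsingleton V := b.repr.toEquiv.subsingleton
    exact ⟨1, RelIso.ext fun U => Subsingleton.elim _ _⟩
  choose! a ha using fun j (hj : j ≠ o) => exists_scaling_of_fixes_axes hΨ hj
  let χ : V ≃ₗ[K] V := b.equiv (b.unitsSMul (Function.update a o 1)) (Equiv.refl ι)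
  have hχo : χ (b o) = b o := by simp [χ, Module.Basis.unitsSMul_apply]
  have hχ : ∀ j, j ≠ o → χ (b j) = (a j : K) • b j := fun j hj => by
    simp [χ, Module.Basis.unitsSMul_apply, hj, Units.smul_def]
  have axis_eq : ∀ j, inducedAut χ (K ∙ b j) = K ∙ b j := by
    intro j
    rw [inducedAut_span_singleton]
    by_cases hj : j = o
    · rw [hj, hχo]
    · rw [hχ j hj, Submodule.span_singleton_smul_eq (a j).isUnit]
  refine ⟨χ, (inv_mul_eq_one.1 (submoduleAut_eq_one_of_fixes_frame b hι (o := o) ?_ ?_)).symm⟩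
  · intro j
    rw [RelIso.mul_apply, hΨ]
    nth_rw 1 [← axis_eq j]
    exact RelIso.inv_apply_self _ _
  · intro j hj
    rw [RelIso.mul_apply, ha j hj, ← hχ j hj]
    nth_rw 1 [← hχo]
    rw [← map_add, ← inducedAut_span_singleton]
    exact RelIso.inv_apply_self _ _

theorem inducedAut_eq_one_of_connected {b : Module.Basis ι K V} {χ : V ≃ₗ[K] V}
    (hχ : ∀ i, inducedAut χ (K ∙ b i) = K ∙ b i) {G : SimpleGraph ι} (hG : G.Connected)
    (hedge : ∀ i j, G.Adj i j → ∃ x y : K, x ≠ 0 ∧ y ≠ 0 ∧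
      inducedAut χ (K ∙ (x • b i + y • b j)) = K ∙ (x • b i + y • b j)) :
    inducedAut χ = 1 := by
  classical
  simp only [inducedAut_span_singleton] at hχ hedge
  have exists_eigenvalue : ∀ {v}, K ∙ χ v = K ∙ v → ∃ a : K, χ v = a • v := fun h => by
    obtain ⟨a, ha⟩ := Submodule.mem_span_singleton.1 (h ▸ Submodule.mem_span_singleton_self _)
    exact ⟨a, ha.symm⟩
  choose a ha using fun i => exists_eigenvalue (hχ i)
  have eq_of_adj : ∀ i j, G.Adj i j → a i = a j := by
    intro i j hij
    obtain ⟨x, y, hx, hy, hxy⟩ := hedge i j hij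
    obtain ⟨c, hc⟩ := exists_eigenvalue hxy
    simp only [map_add, map_smul, ha] at hc
    have hci := congrArg (b.repr · i) hc
    have hcj := congrArg (b.repr · j) hc
    have hai : a i = c := by simpa [hij.ne, hij.ne.symm, mul_comm x, hx] using hci
    have haj : a j = c := by simpa [hij.ne, hij.ne.symm, mul_comm y, hy] using hcj
    rw [hai, haj]
  have a_const : ∀ i j, a i = a j := fun i j => by
    induction (SimpleGraph.reachable_iff_reflTransGen i j).1 (hG.preconnected i j) with
    | refl => rfl
    | tail _ hjk ih => exact ih.trans (eq_of_adj _ _ hjk)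
  obtain ⟨o⟩ := hG.nonempty
  have hχ_smul : ∀ v, χ v = a o • v := LinearMap.congr_fun
    (b.ext (f₁ := (χ : V →ₗ[K] V)) (f₂ := a o • LinearMap.id) fun i => by simp [ha, a_const i o])
  have hao : a o ≠ 0 := fun h => b.ne_zero o (χ.injective (by rw [hχ_smul, h, zero_smul, map_zero]))
  refine submoduleAut_eq_one_of_span_singleton fun v => ?_
  rw [inducedAut_span_singleton, hχ_smul, Submodule.span_singleton_smul_eq hao.isUnit]

end SubspaceLattice

/-! ### Reduced reflection factorizations -/

section ReflectionFactorizations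

variable {B W : Type*} [Group W] {M : CoxeterMatrix B} (cs : CoxeterSystem M W)

/-- The list `L` consists of reflections and is a shortest such list with the given product. -/
def IsReducedFactorization (L : List W) : Prop :=
  (∀ t ∈ L, cs.IsReflection t) ∧ L.length = cs.absLength L.prod

variable {cs}

theorem exists_complement_of_sublist {L' L : List W} (h : L'.Sublist L)
    (hL : ∀ t ∈ L, cs.IsReflection t) :
    ∃ L'' : List W, (∀ t ∈ L'', cs.IsReflection t) ∧ L'.prod * L''.prod = L.prod ∧
      L'.length + L''.length = L.length := by
  induction h with
  | slnil => exact ⟨[], by simp⟩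
  | @cons L' L t _ ih =>
    obtain ⟨ht, hL⟩ := List.forall_mem_cons.1 hL
    obtain ⟨L'', hL'', hprod, hlen⟩ := ih hL
    refine ⟨(L'.prod⁻¹ * t * L'.prod⁻¹⁻¹) :: L'',
      List.forall_mem_cons.2 ⟨ht.conj _, hL''⟩, ?_, ?_⟩
    · rw [List.prod_cons, List.prod_cons, ← hprod]
      group
    · rw [List.length_cons, List.length_cons, ← hlen, add_assoc]
  | @cons_cons L' L t _ ih =>
    obtain ⟨L'', hL'', hprod, hlen⟩ := ih (List.forall_mem_cons.1 hL).2
    refine ⟨L'', hL'', ?_, ?_⟩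
    · rw [List.prod_cons, List.prod_cons, mul_assoc, hprod]
    · rw [List.length_cons, List.length_cons, ← hlen, add_right_comm]

namespace IsReducedFactorization

theorem of_sublist {L' L : List W} (hL : IsReducedFactorization cs L) (h : L'.Sublist L) :
    IsReducedFactorization cs L' ∧ cs.AbsLE L'.prod L.prod := by
  have hL' : ∀ t ∈ L', cs.IsReflection t := fun t ht => hL.1 t (h.subset ht)
  obtain ⟨L'', hL'', hprod, hlen⟩ := exists_complement_of_sublist h hL.1
  have h_sub := cs.absLength_mul_le L'.prod L''.prod
  have h_left := cs.absLength_le L' hL' rfl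
  have h_right := cs.absLength_le L'' hL'' rfl
  rw [hprod, ← hL.2] at h_sub
  refine ⟨⟨hL', by omega⟩, ?_⟩
  rw [AbsLE, ← hL.2, ← hprod, inv_mul_cancel_left]
  omega

theorem absLE_of_mem {L : List W} (hL : IsReducedFactorization cs L) {t : W} (ht : t ∈ L) :
    cs.AbsLE t L.prod := by
  simpa only [List.prod_singleton] using (hL.of_sublist (List.singleton_sublist.2 ht)).2

theorem simple_absLE_wordProd {ω : List B} (hω : IsReducedFactorization cs (ω.map cs.simple))
    {i : B} (hi : i ∈ ω) : cs.AbsLE (cs.simple i) (cs.wordProd ω) :=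
  hω.absLE_of_mem (List.mem_map_of_mem hi)

theorem pair_iff {t u : W} : IsReducedFactorization cs [t, u] ↔
    cs.IsReflection t ∧ cs.IsReflection u ∧ cs.absLength (t * u) = 2 := by
  simp [IsReducedFactorization, and_assoc, eq_comm (a := 2)]

theorem conj_absLE_mul {t u : W} (h : IsReducedFactorization cs [t, u]) :
    cs.AbsLE (t * u * t⁻¹) (t * u) := by
  obtain ⟨ht, hu, hlen⟩ := pair_iff.1 h
  have h' : IsReducedFactorization cs [t * u * t⁻¹, t] :=
    pair_iff.2 ⟨hu.conj t, ht, by rwa [inv_mul_cancel_right]⟩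
  simpa using h'.absLE_of_mem List.mem_cons_self

theorem inv_conj_absLE_mul {t u : W} (h : IsReducedFactorization cs [u, t]) :
    cs.AbsLE (t⁻¹ * u * t) (u * t) := by
  obtain ⟨hu, ht, hlen⟩ := pair_iff.1 h
  have h' : IsReducedFactorization cs [t, t⁻¹ * u * t] :=
    pair_iff.2 ⟨ht, by simpa using hu.conj t⁻¹, by rwa [mul_assoc, mul_inv_cancel_left]⟩
  simpa [mul_assoc] using h'.absLE_of_mem (List.mem_cons_of_mem t List.mem_cons_self)

theorem simple_conj_simple_absLE_wordProd {ω : List B}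
    (hω : IsReducedFactorization cs (ω.map cs.simple)) {i j : B} (hi : i ∈ ω) (hj : j ∈ ω)
    (hij : i ≠ j) : cs.AbsLE (cs.simple i * cs.simple j * (cs.simple i)⁻¹) (cs.wordProd ω) := by
  have pair_sublist : [i, j].Sublist ω ∨ [j, i].Sublist ω := by
    obtain ⟨ω₁, ω₂, rfl⟩ := List.append_of_mem hi
    have hj' : j ∈ ω₁ ∨ j ∈ ω₂ := by simpa [hij.symm] using hj
    rcases hj' with hj' | hj'
    · exact Or.inr ((List.singleton_sublist.2 hj').append
        (List.singleton_sublist.2 List.mem_cons_self))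
    · exact Or.inl (((List.singleton_sublist.2 hj').cons_cons i).trans
        (List.sublist_append_right ω₁ _))
  rcases pair_sublist with h | h <;>
    obtain ⟨hred, hle⟩ := hω.of_sublist (h.map cs.simple) <;>
    simp only [List.map_cons, List.map_nil, List.prod_cons, List.prod_nil, mul_one] at hred hle
  · exact AbsLE.trans cs hred.conj_absLE_mul hle
  · simpa only [cs.inv_simple, wordProd] using AbsLE.trans cs hred.inv_conj_absLE_mul hle

end IsReducedFactorization

end ReflectionFactorizations

/-! ### Automorphisms of the non-crossing partitions given by conjugation -/

section ConjugationAut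

variable {B W : Type*} [Group W] {M : CoxeterMatrix B} (cs : CoxeterSystem M W)

/-- The automorphisms of `NC(W, c)` of the form `w ↦ g w g⁻¹` or `w ↦ g w⁻¹ g⁻¹`. -/
def conjugationAut (c : W) : Subgroup (cs.NC c ≃o cs.NC c) where
  carrier := {φ | ∃ g, (∀ w, (φ w).val = g * w.val * g⁻¹) ∨
    ∀ w, (φ w).val = g * w.val⁻¹ * g⁻¹}
  one_mem' := ⟨1, Or.inl fun w => by simp⟩
  mul_mem' := by
    rintro φ φ' ⟨g, hg⟩ ⟨g', hg'⟩
    refine ⟨g * g', ?_⟩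
    rcases hg with hg | hg <;> rcases hg' with hg' | hg' <;>
      simp [RelIso.mul_apply, hg, hg', mul_assoc]
  inv_mem' := by
    rintro φ ⟨g, hg⟩
    refine ⟨g⁻¹, hg.imp (fun hg w => ?_) fun hg w => ?_⟩ <;>
    · nth_rw 2 [← RelIso.apply_inv_self φ w]
      rw [hg]
      group

variable {cs}

theorem dihedralAut_le_conjugationAut {c l r : W} (h : IsBipartition c l r) :
    cs.dihedralAut h ≤ conjugationAut cs c := by
  rw [dihedralAut, Subgroup.closure_le]
  rintro φ (rfl | rfl)
  · exact ⟨l, Or.inr fun w => by rw [inv_eq_of_mul_eq_one_right h.left_sq]; rfl⟩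
  · exact ⟨r, Or.inr fun w => by rw [inv_eq_of_mul_eq_one_right h.right_sq]; rfl⟩

theorem absLength_apply_of_mem_conjugationAut {c : W} {φ : cs.NC c ≃o cs.NC c}
    (hφ : φ ∈ conjugationAut cs c) (w : cs.NC c) :
    cs.absLength (φ w).val = cs.absLength w.val := by
  obtain ⟨g, hg | hg⟩ := hφ
  · rw [hg, absLength_conj]
  · rw [hg, absLength_conj, absLength_inv]

end ConjugationAut

/-! ### Moved spaces -/

section MovedSpace

variable {K V : Type*} [Ring K] [AddCommGroup V] [Module K V]

/-- The moved space of a linear automorphism `f`, that is, the image of `f - id`. -/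
def movedSpace (f : V ≃ₗ[K] V) : Submodule K V :=
  LinearMap.range ((f : V →ₗ[K] V) - LinearMap.id)

theorem mem_movedSpace {f : V ≃ₗ[K] V} {v : V} : v ∈ movedSpace f ↔ ∃ u, f u - u = v := by
  simp [movedSpace]

theorem movedSpace_one : movedSpace (1 : V ≃ₗ[K] V) = ⊥ :=
  LinearMap.range_eq_bot.2 (sub_self _)

theorem movedSpace_inv (f : V ≃ₗ[K] V) : movedSpace f⁻¹ = movedSpace f := by
  have movedSpace_le_inv : ∀ f : V ≃ₗ[K] V, movedSpace f ≤ movedSpace f⁻¹ := by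
    intro f v hv
    obtain ⟨u, rfl⟩ := mem_movedSpace.1 hv
    exact mem_movedSpace.2 ⟨-f u, by simp [add_comm, sub_eq_add_neg]⟩
  exact le_antisymm (movedSpace_le_inv f⁻¹) (movedSpace_le_inv f)

theorem movedSpace_conj (g f : V ≃ₗ[K] V) :
    movedSpace (g * f * g⁻¹) = (movedSpace f).map (g : V →ₗ[K] V) := by
  ext v
  simp only [Submodule.mem_map, mem_movedSpace]
  constructor
  · rintro ⟨u, rfl⟩
    exact ⟨_, ⟨g⁻¹ u, rfl⟩, by simp⟩
  · rintro ⟨_, ⟨u, rfl⟩, rfl⟩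
    exact ⟨g u, by simp⟩

theorem movedSpace_mul_le (f g : V ≃ₗ[K] V) :
    movedSpace (f * g) ≤ movedSpace f ⊔ movedSpace g := by
  intro v hv
  obtain ⟨u, rfl⟩ := mem_movedSpace.1 hv
  exact Submodule.mem_sup.2 ⟨_, mem_movedSpace.2 ⟨g u, rfl⟩, _, mem_movedSpace.2 ⟨u, rfl⟩,
    sub_add_sub_cancel _ _ _⟩

end MovedSpace

section Moved

variable {B W : Type*} [Fintype B] [DecidableEq B] [Group W] {M : CoxeterMatrix B}
  (cs : CoxeterSystem M W) (d : B → Set.Ioi (0 : ℝ))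

theorem moved_eq_movedSpace (w : W) : cs.moved d w = movedSpace (cs.geomRep d w) :=
  rfl

theorem moved_inv (w : W) : cs.moved d w⁻¹ = cs.moved d w := by
  simp only [moved_eq_movedSpace, map_inv, movedSpace_inv]

theorem moved_conj (g w : W) :
    cs.moved d (g * w * g⁻¹) = (cs.moved d w).map (cs.geomRep d g : (B → ℝ) →ₗ[ℝ] B → ℝ) := by
  simp only [moved_eq_movedSpace, map_mul, map_inv, movedSpace_conj]

theorem moved_mul_le (v w : W) : cs.moved d (v * w) ≤ cs.moved d v ⊔ cs.moved d w := by
  simpa only [moved_eq_movedSpace, map_mul] using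
    movedSpace_mul_le (cs.geomRep d v) (cs.geomRep d w)

theorem moved_one : cs.moved d 1 = ⊥ := by
  rw [moved_eq_movedSpace, map_one, movedSpace_one]

theorem geomRep_simple_apply (i : B) (v : B → ℝ) :
    cs.geomRep d (cs.simple i) v = v - M.simpleCoroot d i v • simpleRoot i := by
  rw [geomRep, lift_apply_simple, CoxeterMatrix.simpleReflection, Module.reflection_apply]

theorem moved_simple (i : B) : cs.moved d (cs.simple i) = ℝ ∙ simpleRoot i := by
  ext v
  refine mem_movedSpace.trans (Iff.trans ?_ Submodule.mem_span_singleton.symm)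
  simp only [geomRep_simple_apply, sub_sub_cancel_left, ← neg_smul]
  constructor
  · rintro ⟨u, rfl⟩
    exact ⟨_, rfl⟩
  · rintro ⟨a, rfl⟩
    refine ⟨(-a / 2) • simpleRoot i, ?_⟩
    rw [map_smul, simpleCoroot_self]
    module

variable {cs d}

theorem moved_eq_span_of_isRootOf {t : W} {α : B → ℝ} (h : cs.IsRootOf d t α) :
    cs.moved d t = ℝ ∙ α := by
  obtain ⟨w, i, rfl, rfl⟩ := h
  rw [moved_conj, moved_simple, Submodule.map_span, Set.image_singleton]
  rfl

variable (cs d)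

theorem finrank_moved_prod_le {L : List W} (hL : ∀ t ∈ L, cs.IsReflection t) :
    Module.finrank ℝ (cs.moved d L.prod) ≤ L.length := by
  induction L with
  | nil => rw [List.prod_nil, moved_one, finrank_bot, List.length_nil]
  | cons t L ih =>
    obtain ⟨⟨g, i, rfl⟩, hL'⟩ := List.forall_mem_cons.1 hL
    have rank_reflection : Module.finrank ℝ (cs.moved d (g * cs.simple i * g⁻¹)) ≤ 1 := by
      rw [moved_eq_span_of_isRootOf ⟨g, i, rfl, rfl⟩]
      exact (finrank_span_le_card _).trans (by simp)
    rw [List.prod_cons, List.length_cons, add_comm]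
    exact (Submodule.finrank_mono (moved_mul_le cs d _ _)).trans
      ((Submodule.finrank_add_le_finrank_add_finrank _ _).trans
        (add_le_add rank_reflection (ih hL')))

theorem finrank_moved_le (w : W) : Module.finrank ℝ (cs.moved d w) ≤ cs.absLength w := by
  obtain ⟨L, hL, rfl, hlen⟩ := cs.exists_absLength w
  exact hlen ▸ finrank_moved_prod_le cs d hL

end Moved

/-! ### Finite Coxeter groups -/

theorem exists_invariant_posDef {G V : Type*} [Group G] [Finite G] [AddCommGroup V] [Module ℝ V]
    (ρ : G →* V ≃ₗ[ℝ] V) {Q : LinearMap.BilinForm ℝ V} (hQ : ∀ x, x ≠ 0 → 0 < Q x x) :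
    ∃ P : LinearMap.BilinForm ℝ V, (∀ g x y, P (ρ g x) (ρ g y) = P x y) ∧
      ∀ x, x ≠ 0 → 0 < P x x := by
  have := Fintype.ofFinite G
  let P : LinearMap.BilinForm ℝ V :=
    ∑ g : G, Q.compl₁₂ (ρ g : V →ₗ[ℝ] V) (ρ g : V →ₗ[ℝ] V)
  have hP : ∀ x y, P x y = ∑ g : G, Q (ρ g x) (ρ g y) := fun x y => by simp [P]
  refine ⟨P, fun g x y => ?_, fun x hx => ?_⟩
  · simp only [hP, ← LinearEquiv.mul_apply, ← map_mul]
    exact Fintype.sum_equiv (Equiv.mulRight g) _ _ fun w => rfl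
  · rw [hP]
    exact Finset.sum_pos (fun g _ => hQ _ ((ρ g).map_ne_zero_iff.2 hx)) Finset.univ_nonempty

section FiniteCoxeterGroup

variable {B W : Type*} [Group W] {M : CoxeterMatrix B} {cs : CoxeterSystem M W}

section

variable [Fintype B] [DecidableEq B] {d : B → Set.Ioi (0 : ℝ)}

theorem eq_zero_of_forall_eq_zero_or_simpleCoroot_eq_zero [Finite W] (cs : CoxeterSystem M W)
    {v : B → ℝ} (hv : ∀ i, v i = 0 ∨ M.simpleCoroot d i v = 0) : v = 0 := by
  obtain ⟨P, P_inv, P_pos⟩ := exists_invariant_posDef (cs.geomRep d)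
    (Q := dotProductBilin ℝ ℝ) fun x hx => by
      simpa using Matrix.dotProduct_star_self_pos_iff.2 hx
  have P_root : ∀ i, M.simpleCoroot d i v = 0 → P (simpleRoot i) v = 0 := by
    intro i hi
    have h := P_inv (cs.simple i) (simpleRoot i) v
    rw [geomRep_simple_apply, geomRep_simple_apply, simpleCoroot_self, hi, zero_smul, sub_zero,
      two_smul, sub_add_cancel_left, map_neg, LinearMap.neg_apply] at h
    linarith
  have P_self : P v v = 0 := by
    have hsum : v = ∑ i, v i • simpleRoot i := pi_eq_sum_univ' v
    nth_rw 1 [hsum]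
    simp only [map_sum, map_smul, LinearMap.sum_apply, LinearMap.smul_apply, smul_eq_mul]
    exact Finset.sum_eq_zero fun i _ => (hv i).elim (fun h => by rw [h, zero_mul])
      fun h => by rw [P_root i h, mul_zero]
  by_contra hv0
  exact (P_pos v hv0).ne' P_self

theorem geomRep_wordProd_apply_of_notMem {ω : List B} {k : B} (hk : k ∉ ω) (v : B → ℝ) :
    cs.geomRep d (cs.wordProd ω) v k = v k := by
  induction ω with
  | nil => simp
  | cons i ω ih =>
    rw [List.mem_cons, not_or] at hk
    rw [wordProd_cons, map_mul, LinearEquiv.mul_apply, geomRep_simple_apply, Pi.sub_apply,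
      ih hk.2]
    simp [simpleRoot, hk.1]

theorem simpleCoroot_eq_zero_of_wordProd_fixed {ω : List B} (hω : ω.Nodup) {v : B → ℝ}
    (hv : cs.geomRep d (cs.wordProd ω) v = v) : ∀ i ∈ ω, M.simpleCoroot d i v = 0 := by
  induction ω with
  | nil => exact List.forall_mem_nil _
  | cons i ω ih =>
    obtain ⟨hiω, hω⟩ := List.nodup_cons.1 hω
    have tail_apply : cs.geomRep d (cs.wordProd ω) v = cs.geomRep d (cs.simple i) v := by
      nth_rw 2 [← hv]
      rw [← LinearEquiv.mul_apply, ← map_mul, wordProd_cons, simple_mul_simple_cancel_left]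
    have hi : M.simpleCoroot d i v = 0 := by
      simpa [tail_apply, geomRep_simple_apply, simpleRoot] using
        geomRep_wordProd_apply_of_notMem (cs := cs) (d := d) hiω v
    have tail_fixed : cs.geomRep d (cs.wordProd ω) v = v := by
      rw [tail_apply, geomRep_simple_apply, hi, zero_smul, sub_zero]
    exact List.forall_mem_cons.2 ⟨hi, ih hω tail_fixed⟩

theorem moved_coxeterElement [Finite W] {c : W} (hc : cs.IsCoxeterElement c) :
    cs.moved d c = ⊤ := by
  obtain ⟨ω, hω, hω_mem, hconj⟩ := hc
  obtain ⟨g, rfl⟩ := isConj_iff.1 hconj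
  have moved_wordProd : cs.moved d (cs.wordProd ω) = ⊤ := by
    rw [moved, LinearMap.range_eq_top, ← LinearMap.injective_iff_surjective,
      ← LinearMap.ker_eq_bot, LinearMap.ker_eq_bot']
    intro v hv
    refine eq_zero_of_forall_eq_zero_or_simpleCoroot_eq_zero (d := d) cs fun i => Or.inr ?_
    exact simpleCoroot_eq_zero_of_wordProd_fixed hω (sub_eq_zero.1 hv) i (hω_mem i)
  rw [moved_conj, moved_wordProd, Submodule.map_top, LinearEquiv.range]

end

theorem absLength_coxeterElement [Finite B] [Finite W] {c : W} (hc : cs.IsCoxeterElement c) :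
    cs.absLength c = Nat.card B := by
  classical
  have := Fintype.ofFinite B
  rw [Nat.card_eq_fintype_card]
  apply le_antisymm
  · obtain ⟨ω, hω, -, hconj⟩ := hc
    obtain ⟨g, rfl⟩ := isConj_iff.1 hconj
    rw [absLength_conj]
    refine (cs.absLength_le (ω.map cs.simple) ?_ rfl).trans ?_
    · exact List.forall_mem_map.2 fun i _ => cs.isReflection_simple i
    · rw [List.length_map]
      exact hω.length_le_card
  · have h := finrank_moved_le cs unitLengths c
    rwa [moved_coxeterElement hc, finrank_top, Module.finrank_fintype_fun_eq_card] at h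

theorem exists_conj_absLE_coxeterElement [Finite B] [Finite W] {c : W}
    (hc : cs.IsCoxeterElement c) :
    ∃ k, (∀ i, cs.AbsLE (k * cs.simple i * k⁻¹) c) ∧ ∀ i j, i ≠ j →
      cs.AbsLE (k * (cs.simple i * cs.simple j * (cs.simple i)⁻¹) * k⁻¹) c := by
  have := Fintype.ofFinite B
  have hlen := absLength_coxeterElement hc
  obtain ⟨ω, hω, hω_mem, hconj⟩ := hc
  obtain ⟨k, rfl⟩ := isConj_iff.1 hconj
  have hred : IsReducedFactorization cs (ω.map cs.simple) := by
    refine ⟨List.forall_mem_map.2 fun i _ => cs.isReflection_simple i, ?_⟩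
    rw [absLength_conj, Nat.card_eq_fintype_card] at hlen
    refine le_antisymm ?_ (cs.absLength_le _
      (List.forall_mem_map.2 fun i _ => cs.isReflection_simple i) rfl)
    rw [List.length_map]
    exact hω.length_le_card.trans hlen.ge
  exact ⟨k, fun i => AbsLE.conj cs (hred.simple_absLE_wordProd (hω_mem i)) k, fun i j hij =>
    AbsLE.conj cs (hred.simple_conj_simple_absLE_wordProd (hω_mem i) (hω_mem j) hij) k⟩

variable [Fintype B] [DecidableEq B] {d : B → Set.Ioi (0 : ℝ)} [Finite W] {c w : W}

theorem moved_eq_top_iff_of_absLE (hc : cs.IsCoxeterElement c) (hw : cs.AbsLE w c) :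
    cs.moved d w = ⊤ ↔ w = c := by
  refine ⟨fun h => ?_, fun h => h ▸ moved_coxeterElement hc⟩
  have hrank := finrank_moved_le cs d w
  rw [h, finrank_top, Module.finrank_fintype_fun_eq_card, ← Nat.card_eq_fintype_card,
    ← absLength_coxeterElement hc, hw] at hrank
  exact inv_mul_eq_one.1 (cs.eq_one_of_absLength_eq_zero (by omega))

theorem moved_eq_bot_iff_of_absLE (hc : cs.IsCoxeterElement c) (hw : cs.AbsLE w c) :
    cs.moved d w = ⊥ ↔ w = 1 := by
  refine ⟨fun h => ?_, fun h => h ▸ moved_one cs d⟩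
  have hcomp := moved_mul_le cs d w (w⁻¹ * c)
  rw [mul_inv_cancel_left, moved_coxeterElement hc, h, bot_sup_eq, top_le_iff] at hcomp
  have hrank := finrank_moved_le cs d (w⁻¹ * c)
  rw [hcomp, finrank_top, Module.finrank_fintype_fun_eq_card, ← Nat.card_eq_fintype_card,
    ← absLength_coxeterElement hc, hw] at hrank
  exact cs.eq_one_of_absLength_eq_zero (by omega)

end FiniteCoxeterGroup

/-! ### Roots -/

section Roots

variable {B W : Type*} [Fintype B] [DecidableEq B] [Group W] {M : CoxeterMatrix B}
  (cs : CoxeterSystem M W) (d : B → Set.Ioi (0 : ℝ))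

/-- The root system is reduced: a root has no multiples among the roots other than `± 1`. -/
def HasReducedRoots : Prop :=
  ∀ α ∈ cs.roots d, ∀ k : ℝ, k • α ∈ cs.roots d → k = 1 ∨ k = -1

theorem rootForm_comm (x y : B → ℝ) : M.rootForm d x y = M.rootForm d y x := by
  simp only [CoxeterMatrix.rootForm, Matrix.toBilin'_apply, Matrix.of_apply]
  rw [Finset.sum_comm]
  refine Finset.sum_congr rfl fun i _ => Finset.sum_congr rfl fun j _ => ?_
  rw [M.symmetric j i]
  ring

theorem rootForm_geomRep (w : W) (x y : B → ℝ) :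
    M.rootForm d (cs.geomRep d w x) (cs.geomRep d w y) = M.rootForm d x y := by
  induction w using cs.simple_induction generalizing x y with
  | simple i =>
    have hi : M.rootForm d (simpleRoot i) (simpleRoot i) ≠ 0 := by
      rw [rootForm_simpleRoot_self]
      exact pow_ne_zero 2 (d i).2.ne'
    simp only [geomRep_simple_apply, CoxeterMatrix.simpleCoroot, map_sub, map_smul,
      LinearMap.sub_apply, LinearMap.smul_apply, smul_eq_mul, rootForm_comm d x (simpleRoot i)]
    field_simp
    ring
  | one => simp
  | mul w w' h h' => rw [map_mul, LinearEquiv.mul_apply, LinearEquiv.mul_apply, h, h']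

theorem hasReducedRoots_unitLengths : HasReducedRoots cs unitLengths := by
  have norm_root : ∀ α ∈ cs.roots unitLengths, M.rootForm unitLengths α α = 1 := by
    rintro _ ⟨w, i, rfl⟩
    rw [rootForm_geomRep, rootForm_simpleRoot_self]
    simp [unitLengths]
  intro α hα k hk
  have h := norm_root _ hk
  rwa [map_smul, map_smul, LinearMap.smul_apply, norm_root α hα, smul_eq_mul, smul_eq_mul,
    mul_one, mul_self_eq_one_iff] at h

variable {cs d}

theorem isRootOf_geomRep {t : W} {α : B → ℝ} (h : cs.IsRootOf d t α) (g : W) :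
    cs.IsRootOf d (g * t * g⁻¹) (cs.geomRep d g α) := by
  obtain ⟨w, i, rfl, rfl⟩ := h
  exact ⟨g * w, i, by group, by rw [map_mul, LinearEquiv.mul_apply]⟩

theorem mem_roots_of_isRootOf {t : W} {α : B → ℝ} (h : cs.IsRootOf d t α) : α ∈ cs.roots d := by
  obtain ⟨w, i, -, rfl⟩ := h
  exact ⟨w, i, rfl⟩

theorem HasReducedRoots.eq_or_eq_neg_of_isRootOf (hd : HasReducedRoots cs d) {t : W}
    {α β : B → ℝ} (hα : cs.IsRootOf d t α) (hβ : cs.IsRootOf d t β) : α = β ∨ α = -β := by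
  have hβα : α ∈ ℝ ∙ β := by
    rw [← moved_eq_span_of_isRootOf hβ, moved_eq_span_of_isRootOf hα]
    exact Submodule.mem_span_singleton_self α
  obtain ⟨k, rfl⟩ := Submodule.mem_span_singleton.1 hβα
  rcases hd β (mem_roots_of_isRootOf hβ) k (mem_roots_of_isRootOf hα) with rfl | rfl
  · exact Or.inl (one_smul _ _)
  · exact Or.inr (neg_one_smul _ _)

theorem simpleCoroot_simpleRoot_neg {i j : B} (hij : i ≠ j) (hM : M i j ≠ 2) :
    M.simpleCoroot d i (simpleRoot j) < 0 := by
  have hM1 : M i j ≠ 1 := M.off_diagonal i j hij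
  have hi : (0 : ℝ) < d i := (d i).2
  have hj : (0 : ℝ) < d j := (d j).2
  have cos_pos : 0 < Real.cos (Real.pi / M i j) := by
    rcases Nat.eq_zero_or_pos (M i j) with hM0 | hM0
    · simp [hM0]
    · have hM3 : (3 : ℝ) ≤ M i j := by exact_mod_cast (by omega : 3 ≤ M i j)
      refine Real.cos_pos_of_mem_Ioo ⟨?_, ?_⟩
      · have : 0 < Real.pi / M i j := div_pos Real.pi_pos (by linarith)
        linarith [Real.pi_pos]
      · exact div_lt_div_of_pos_left Real.pi_pos two_pos (by linarith)
  rw [simpleCoroot_simpleRoot, neg_lt_zero]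
  positivity

theorem simpleCoroot_mul_simpleCoroot_lt_four [Finite W] (cs : CoxeterSystem M W)
    (d : B → Set.Ioi (0 : ℝ)) {i j : B} (hij : i ≠ j) :
    M.simpleCoroot d i (simpleRoot j) * M.simpleCoroot d j (simpleRoot i) < 4 := by
  set a := M.simpleCoroot d i (simpleRoot j) with ha
  set a' := M.simpleCoroot d j (simpleRoot i) with ha'
  have product_eq : a * a' = 4 * Real.cos (Real.pi / M i j) ^ 2 := by
    have hi : (d i : ℝ) ≠ 0 := (d i).2.ne'
    have hj : (d j : ℝ) ≠ 0 := (d j).2.ne'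
    rw [ha, ha', simpleCoroot_simpleRoot, simpleCoroot_simpleRoot, M.symmetric j i]
    field_simp
    ring
  refine lt_of_le_of_ne (by linarith [Real.cos_sq_le_one (Real.pi / M i j)]) fun h4 => ?_
  -- If the product were `4`, this vector would span the radical of the form on the plane.
  have radical_eq_zero : (-a) • simpleRoot i + (2 : ℝ) • simpleRoot j = (0 : B → ℝ) := by
    refine eq_zero_of_forall_eq_zero_or_simpleCoroot_eq_zero (d := d) cs fun k => ?_
    rcases eq_or_ne k i with rfl | hki
    · right
      rw [map_add, map_smul, map_smul, simpleCoroot_self, ← ha, smul_eq_mul, smul_eq_mul]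
      ring
    rcases eq_or_ne k j with rfl | hkj
    · right
      rw [map_add, map_smul, map_smul, simpleCoroot_self, ← ha', smul_eq_mul, smul_eq_mul]
      linarith
    · left
      simp [simpleRoot, hki, hkj]
  have h2 := congrFun radical_eq_zero j
  simp [simpleRoot, hij.symm] at h2

theorem exists_simpleCoroot_simpleRoot_eq_int (hd : cs.IsCrystallographic d) (i j : B) :
    ∃ n : ℤ, M.simpleCoroot d i (simpleRoot j) = n := by
  have simpleRoot_mem : ∀ k, simpleRoot k ∈ cs.roots d := fun k => ⟨1, k, by simp⟩
  obtain ⟨n, hn⟩ := hd.integral _ (simpleRoot_mem j) _ (simpleRoot_mem i)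
  refine ⟨n, ?_⟩
  rw [← hn, CoxeterMatrix.simpleCoroot, LinearMap.smul_apply, smul_eq_mul,
    rootForm_comm d (simpleRoot i) (simpleRoot j), div_mul_eq_mul_div]

theorem geomRep_simple_simpleRoot_eq_add [Finite W] (hd : cs.IsCrystallographic d) {i j : B}
    (hij : i ≠ j) (hM : M i j ≠ 2) :
    cs.geomRep d (cs.simple i) (simpleRoot j) = simpleRoot j + simpleRoot i ∨
      cs.geomRep d (cs.simple j) (simpleRoot i) = simpleRoot i + simpleRoot j := by
  have eq_add : ∀ {k l}, M.simpleCoroot d k (simpleRoot l) = -1 →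
      cs.geomRep d (cs.simple k) (simpleRoot l) = simpleRoot l + simpleRoot k := fun h => by
    rw [geomRep_simple_apply, h, neg_one_smul, sub_neg_eq_add]
  obtain ⟨m, hm⟩ := exists_simpleCoroot_simpleRoot_eq_int hd i j
  obtain ⟨n, hn⟩ := exists_simpleCoroot_simpleRoot_eq_int hd j i
  have hm_neg : m < 0 := by
    exact_mod_cast hm ▸ simpleCoroot_simpleRoot_neg (d := d) hij hM
  have hn_neg : n < 0 := by
    exact_mod_cast hn ▸ simpleCoroot_simpleRoot_neg (d := d) hij.symm (M.symmetric i j ▸ hM)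
  have hmn : m * n < 4 := by
    have h := simpleCoroot_mul_simpleCoroot_lt_four cs d hij
    rw [hm, hn] at h
    exact_mod_cast h
  have hm_or_hn : m = -1 ∨ n = -1 := by
    by_contra! h
    nlinarith [show m ≤ -2 by omega, show n ≤ -2 by omega]
  rcases hm_or_hn with rfl | rfl
  · exact Or.inl (eq_add (by exact_mod_cast hm))
  · exact Or.inr (eq_add (by exact_mod_cast hn))

end Roots

/-! ### Automorphisms of order complexes -/

section OrderComplex

variable {P L : Type*} [PartialOrder P] [BoundedOrder P] [PartialOrder L] [BoundedOrder L]

theorem properPerm_mem_typePreservingAut {type : P → ℕ} (φ : P ≃o P)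
    (hφ : ∀ x, type (φ x) = type x) :
    properPerm φ ∈ typePreservingAut (orderComplex P) fun x => type x.1 := by
  let φ' : ProperPart P ≃o ProperPart P := ⟨properPerm φ, φ.le_iff_le⟩
  refine ⟨fun s => and_congr Finset.map_nonempty ?_, fun x => hφ x.1⟩
  rw [Finset.coe_map]
  exact IsChain.image_relIso_iff (φ := φ')

theorem monotone_of_mem_typePreservingAut {type : ProperPart P → ℕ} (htype : StrictMono type)
    {Θ : Equiv.Perm (ProperPart P)} (hΘ : Θ ∈ typePreservingAut (orderComplex P) type) :
    Monotone Θ := by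
  classical
  intro x y hxy
  have hface : ({x, y} : Finset (ProperPart P)) ∈ (orderComplex P).faces :=
    ⟨Finset.insert_nonempty x {y}, by simpa only [Finset.coe_pair] using IsChain.pair hxy⟩
  have himage := ((hΘ.1 {x, y}).2 hface).2
  rcases himage.total (x := Θ x) (y := Θ y) (by simp) (by simp) with h | h
  · exact h
  · have htype_le : type (Θ x) ≤ type (Θ y) := by simpa only [hΘ.2] using htype.monotone hxy
    exact (h.eq_or_lt.resolve_right fun h => (htype h).not_ge htype_le).ge

theorem monotone_ofSubtype [DecidablePred fun x : P => x ≠ ⊥ ∧ x ≠ ⊤]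
    {Θ : Equiv.Perm (ProperPart P)} (hΘ : Monotone Θ) : Monotone (Equiv.Perm.ofSubtype Θ) := by
  have map_bot : Equiv.Perm.ofSubtype Θ ⊥ = ⊥ :=
    Equiv.Perm.ofSubtype_apply_of_not_mem Θ fun h => h.1 rfl
  have map_top : Equiv.Perm.ofSubtype Θ ⊤ = ⊤ :=
    Equiv.Perm.ofSubtype_apply_of_not_mem Θ fun h => h.2 rfl
  intro x y hxy
  by_cases hx : x = ⊥
  · rw [hx, map_bot]
    exact bot_le
  by_cases hy : y = ⊤
  · rw [hy, map_top]
    exact le_top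
  have hx_proper : x ≠ ⊥ ∧ x ≠ ⊤ := ⟨hx, ne_top_of_le_ne_top hy hxy⟩
  have hy_proper : y ≠ ⊥ ∧ y ≠ ⊤ := ⟨ne_bot_of_le_ne_bot hx hxy, hy⟩
  rw [Equiv.Perm.ofSubtype_apply_of_mem Θ hx_proper, Equiv.Perm.ofSubtype_apply_of_mem Θ hy_proper]
  exact @hΘ ⟨x, hx_proper⟩ ⟨y, hy_proper⟩ hxy

theorem exists_properPerm_eq {type : ProperPart P → ℕ} (htype : StrictMono type)
    {Θ : Equiv.Perm (ProperPart P)} (hΘ : Θ ∈ typePreservingAut (orderComplex P) type) :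
    ∃ Ψ : P ≃o P, properPerm Ψ = Θ := by
  classical
  have hmono := monotone_ofSubtype (monotone_of_mem_typePreservingAut htype hΘ)
  have hmono_inv : Monotone (Equiv.Perm.ofSubtype Θ).symm := by
    rw [← Equiv.Perm.inv_def, ← map_inv]
    exact monotone_ofSubtype (monotone_of_mem_typePreservingAut htype (inv_mem hΘ))
  exact ⟨(Equiv.Perm.ofSubtype Θ).toOrderIso hmono hmono_inv,
    Equiv.ext fun x => Subtype.ext (Equiv.Perm.ofSubtype_apply_of_mem Θ x.2)⟩

theorem extendsAlong_iff_extendsAlongSimplicially {f : P → L} (hbot : ∀ x, f x = ⊥ ↔ x = ⊥)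
    (htop : ∀ x, f x = ⊤ ↔ x = ⊤) {φ : P ≃o P} {Ψ : L ≃o L} :
    ExtendsAlong f φ Ψ ↔ ExtendsAlongSimplicially f (properPerm φ) (properPerm Ψ) := by
  refine ⟨fun h x => ⟨⟨(hbot x).not.2 x.2.1, (htop x).not.2 x.2.2⟩, h x⟩, fun h x => ?_⟩
  by_cases hx_bot : x = ⊥
  · rw [hx_bot, map_bot, (hbot ⊥).2 rfl, map_bot]
  by_cases hx_top : x = ⊤
  · rw [hx_top, map_top, (htop ⊤).2 rfl, map_top]
  · obtain ⟨_, hx⟩ := h ⟨x, hx_bot, hx_top⟩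
    exact hx

end OrderComplex

/-! ### Unique extension along a moved-space map -/

theorem inv_mul_apply_of_extendsAlong {P L : Type*} [PartialOrder P] [PartialOrder L] {f : P → L}
    {φ : P ≃o P} {Ψ Ψ' : L ≃o L} (hΨ : ExtendsAlong f φ Ψ) (hΨ' : ExtendsAlong f φ Ψ') (x : P) :
    (Ψ'⁻¹ * Ψ) (f x) = f x := by
  rw [RelIso.mul_apply, hΨ, ← hΨ', RelIso.inv_apply_self]

theorem properPerm_inducedAut_mem_buildingAut {K V : Type*} [Field K] [AddCommGroup V]
    [Module K V] (ψ : V ≃ₗ[K] V) : properPerm (inducedAut ψ) ∈ buildingAut K V :=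
  properPerm_mem_typePreservingAut (type := fun U : Submodule K V => Module.finrank K U)
    (inducedAut ψ) ψ.finrank_map_eq

theorem properPerm_mem_complexAut {B W : Type*} [Group W] {M : CoxeterMatrix B}
    {cs : CoxeterSystem M W} {c : W} {φ : cs.NC c ≃o cs.NC c} (hφ : φ ∈ conjugationAut cs c) :
    properPerm φ ∈ cs.complexAut c :=
  properPerm_mem_typePreservingAut (type := fun w : cs.NC c => cs.absLength w.val) φ
    (absLength_apply_of_mem_conjugationAut hφ)

section MovedMap

variable {B W : Type*} [DecidableEq B] [Group W] {M : CoxeterMatrix B} (cs : CoxeterSystem M W)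
  {K : Type*} [Field K]

/-- The map `F` behaves below the Coxeter element `c` like the moved space with respect to a
representation on `B → K` whose standard basis vectors are the simple roots: it is equivariant for
the maps `ρ g`, which permute the roots. This is what the real moved spaces and their reductions
modulo a prime have in common. -/
structure IsMovedMap (c : W) (F : W → Submodule K (B → K)) (IsRoot : W → (B → K) → Prop)
    (ρ : W → (B → K) ≃ₗ[K] (B → K)) : Prop where
  conj : ∀ g w, F (g * w * g⁻¹) = (F w).map (ρ g : (B → K) →ₗ[K] (B → K))
  inv : ∀ w, F w⁻¹ = F w
  eq_bot_iff : ∀ w, cs.AbsLE w c → (F w = ⊥ ↔ w = 1)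
  eq_top_iff : ∀ w, cs.AbsLE w c → (F w = ⊤ ↔ w = c)
  root : ∀ g t α, IsRoot t α → IsRoot (g * t * g⁻¹) (ρ g α)
  root_unique : ∀ t α β, IsRoot t α → IsRoot t β → α = β ∨ α = -β
  simple : ∀ i, F (cs.simple i) = K ∙ (Pi.single i 1 : B → K)
  edge : ∀ i j, i ≠ j → M i j ≠ 2 → ∃ a : K, a ≠ 0 ∧
    (ρ (cs.simple i) (Pi.single j 1) = Pi.single j 1 + a • Pi.single i 1 ∨
      ρ (cs.simple j) (Pi.single i 1) = Pi.single i 1 + a • Pi.single j 1)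

namespace IsMovedMap

variable {cs} {c : W} {F : W → Submodule K (B → K)} {IsRoot : W → (B → K) → Prop}
  {ρ : W → (B → K) ≃ₗ[K] (B → K)} {φ : cs.NC c ≃o cs.NC c}

theorem conj_simple (hF : IsMovedMap cs c F IsRoot ρ) (g : W) (i : B) :
    F (g * cs.simple i * g⁻¹) = K ∙ ρ g (Pi.single i 1) := by
  rw [hF.conj, hF.simple, ← inducedAut_apply, inducedAut_span_singleton]

theorem conj_simple_conj_simple (hF : IsMovedMap cs c F IsRoot ρ) (g : W) (i j : B) :
    F (g * (cs.simple i * cs.simple j * (cs.simple i)⁻¹) * g⁻¹) =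
      K ∙ ρ g (ρ (cs.simple i) (Pi.single j 1)) := by
  rw [hF.conj, hF.conj_simple, ← inducedAut_apply, inducedAut_span_singleton]

theorem exists_basis [Finite B] [Finite W] (hF : IsMovedMap cs c F IsRoot ρ)
    (hc : cs.IsCoxeterElement c) :
    ∃ b : Module.Basis B K (B → K), (∀ i, ∃ w, cs.AbsLE w c ∧ F w = K ∙ b i) ∧
      ∀ i j, i ≠ j → M i j ≠ 2 → ∃ (w : W) (x y : K), cs.AbsLE w c ∧ x ≠ 0 ∧
        y ≠ 0 ∧ F w = K ∙ (x • b i + y • b j) := by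
  obtain ⟨k, h_simple, h_conj⟩ := exists_conj_absLE_coxeterElement hc
  have hb : ∀ i, (Pi.basisFun K B).map (ρ k) i = ρ k (Pi.single i 1) := fun i => by
    rw [Module.Basis.map_apply, Pi.basisFun_apply]
  refine ⟨(Pi.basisFun K B).map (ρ k), fun i => ⟨_, h_simple i, ?_⟩, fun i j hij hM => ?_⟩
  · rw [hF.conj_simple, hb]
  obtain ⟨a, ha, hρ | hρ⟩ := hF.edge i j hij hM
  · refine ⟨_, a, 1, h_conj i j hij, ha, one_ne_zero, ?_⟩
    rw [hF.conj_simple_conj_simple, hρ, map_add, map_smul, one_smul, hb, hb, add_comm]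
  · refine ⟨_, 1, a, h_conj j i hij.symm, one_ne_zero, ha, ?_⟩
    rw [hF.conj_simple_conj_simple, hρ, map_add, map_smul, one_smul, hb, hb]

theorem inducedAut_eq_one [Finite B] [Finite W] (hF : IsMovedMap cs c F IsRoot ρ)
    (hc : cs.IsCoxeterElement c) (hM : M.IsIrreducible) {χ : (B → K) ≃ₗ[K] (B → K)}
    (hχ : ∀ w, cs.AbsLE w c → inducedAut χ (F w) = F w) : inducedAut χ = 1 := by
  obtain ⟨b, h_axis, h_edge⟩ := hF.exists_basis hc
  refine inducedAut_eq_one_of_connected (b := b) (fun i => ?_) hM fun i j hij => ?_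
  · obtain ⟨w, hw, hFw⟩ := h_axis i
    exact hFw ▸ hχ w hw
  · rw [SimpleGraph.fromRel_adj, M.symmetric j i, or_self] at hij
    obtain ⟨w, x, y, hw, hx, hy, hFw⟩ := h_edge i j hij.1 hij.2
    exact ⟨x, y, hx, hy, hFw ▸ hχ w hw⟩

theorem submoduleAut_eq_one [Finite B] [Finite W] [Subsingleton (K →+* K)]
    (hF : IsMovedMap cs c F IsRoot ρ) (hc : cs.IsCoxeterElement c) (hM : M.IsIrreducible)
    (hB : Nat.card B ≠ 2) {Ψ : Submodule K (B → K) ≃o Submodule K (B → K)}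
    (hΨ : ∀ w, cs.AbsLE w c → Ψ (F w) = F w) : Ψ = 1 := by
  obtain ⟨b, h_axis, -⟩ := hF.exists_basis hc
  have h_fixes : ∀ i, Ψ (K ∙ b i) = K ∙ b i := fun i => by
    obtain ⟨w, hw, hFw⟩ := h_axis i
    exact hFw ▸ hΨ w hw
  obtain ⟨χ, rfl⟩ := exists_eq_inducedAut_of_fixes_axes b hB h_fixes
  exact hF.inducedAut_eq_one hc hM hΨ

theorem eq_inducedAut_of_linear [Finite B] [Finite W] (hF : IsMovedMap cs c F IsRoot ρ)
    (hc : cs.IsCoxeterElement c) (hM : M.IsIrreducible) {ψ ψ' : (B → K) ≃ₗ[K] (B → K)}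
    (hψ : ExtendsAlong (fun w => F w.val) φ (inducedAut ψ))
    (hψ' : ExtendsAlong (fun w => F w.val) φ (inducedAut ψ')) :
    inducedAut ψ' = inducedAut ψ := by
  have h_one : inducedAut (ψ⁻¹ * ψ') = 1 := by
    refine hF.inducedAut_eq_one hc hM fun w hw => ?_
    rw [inducedAut_mul, inducedAut_inv]
    exact inv_mul_apply_of_extendsAlong hψ' hψ ⟨w, hw⟩
  rw [inducedAut_mul, inducedAut_inv] at h_one
  exact (inv_mul_eq_one.1 h_one).symm

theorem eq_inducedAut [Finite B] [Finite W] [Subsingleton (K →+* K)]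
    (hF : IsMovedMap cs c F IsRoot ρ) (hc : cs.IsCoxeterElement c) (hM : M.IsIrreducible)
    (hB : Nat.card B ≠ 2) {ψ : (B → K) ≃ₗ[K] (B → K)}
    {Ψ : Submodule K (B → K) ≃o Submodule K (B → K)}
    (hψ : ExtendsAlong (fun w => F w.val) φ (inducedAut ψ))
    (hΨ : ExtendsAlong (fun w => F w.val) φ Ψ) : Ψ = inducedAut ψ :=
  (inv_mul_eq_one.1 (hF.submoduleAut_eq_one hc hM hB fun w hw =>
    inv_mul_apply_of_extendsAlong hΨ hψ ⟨w, hw⟩)).symm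

theorem extendsAlong_iff_simplicially (hF : IsMovedMap cs c F IsRoot ρ)
    {Ψ : Submodule K (B → K) ≃o Submodule K (B → K)} :
    ExtendsAlong (fun w => F w.val) φ Ψ ↔
      ExtendsAlongSimplicially (fun w => F w.val) (properPerm φ) (properPerm Ψ) :=
  extendsAlong_iff_extendsAlongSimplicially
    (fun w : cs.NC c => (hF.eq_bot_iff w.val w.absLE).trans (NC.ext_iff (y := ⊥)).symm)
    (fun w : cs.NC c => (hF.eq_top_iff w.val w.absLE).trans (NC.ext_iff (y := ⊤)).symm)

theorem eq_properPerm_inducedAut [Finite B] [Finite W] [Subsingleton (K →+* K)]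
    (hF : IsMovedMap cs c F IsRoot ρ) (hc : cs.IsCoxeterElement c) (hM : M.IsIrreducible)
    (hB : Nat.card B ≠ 2) {ψ : (B → K) ≃ₗ[K] (B → K)}
    (hψ : ExtendsAlong (fun w => F w.val) φ (inducedAut ψ))
    {Θ : Equiv.Perm (ProperPart (Submodule K (B → K)))} (hΘ : Θ ∈ buildingAut K (B → K))
    (hΘφ : ExtendsAlongSimplicially (fun w => F w.val) (properPerm φ) Θ) :
    Θ = properPerm (inducedAut ψ) := by
  obtain ⟨Ψ, rfl⟩ := exists_properPerm_eq
    (fun _ _ hU => Submodule.finrank_lt_finrank_of_lt hU) hΘ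
  rw [hF.eq_inducedAut hc hM hB hψ (hF.extendsAlong_iff_simplicially.2 hΘφ)]

theorem exists_extendsAlong (hF : IsMovedMap cs c F IsRoot ρ) (hφ : φ ∈ conjugationAut cs c) :
    ∃ ψ : (B → K) ≃ₗ[K] (B → K),
      (∀ t : cs.NC c, cs.IsReflection t.val → ∀ α β, IsRoot t.val α → IsRoot (φ t).val β →
        ψ α = β ∨ ψ α = -β) ∧
      ExtendsAlong (fun w => F w.val) φ (inducedAut ψ) := by
  obtain ⟨g, hg⟩ := hφ
  refine ⟨ρ g, fun t ht α β hα hβ => ?_, fun w => ?_⟩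
  · have hφt : (φ t).val = g * t.val * g⁻¹ :=
      hg.elim (fun hg => hg t) fun hg => by rw [hg, ht.inv]
    exact hF.root_unique _ _ _ (hφt ▸ hF.root g _ _ hα) hβ
  · change inducedAut (ρ g) (F w.val) = F (φ w).val
    rcases hg with hg | hg
    · rw [hg, hF.conj, inducedAut_apply]
    · rw [hg, hF.conj, hF.inv, inducedAut_apply]

theorem extendsUniquely [Finite B] [Finite W] [Subsingleton (K →+* K)]
    (hF : IsMovedMap cs c F IsRoot ρ) (hc : cs.IsCoxeterElement c)
    (hφ : φ ∈ conjugationAut cs c) :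
    cs.ExtendsUniquely (fun w => F w.val) IsRoot φ := by
  obtain ⟨ψ, hψ_root, hψ⟩ := hF.exists_extendsAlong hφ
  refine ⟨properPerm_mem_complexAut hφ, ψ, hψ_root, hψ, properPerm_inducedAut_mem_buildingAut ψ,
    hF.extendsAlong_iff_simplicially.1 hψ,
    fun hM ψ' => hF.eq_inducedAut_of_linear hc hM hψ, fun hM hB => ?_⟩
  have := Fintype.ofFinite B
  rw [Module.finrank_fintype_fun_eq_card, ← Nat.card_eq_fintype_card] at hB
  exact ⟨fun Ψ => hF.eq_inducedAut hc hM hB hψ,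
    fun Θ => hF.eq_properPerm_inducedAut hc hM hB hψ⟩

end IsMovedMap

end MovedMap

/-! ### Real moved spaces -/

section RealMovedSpaces

variable {B W : Type*} [Fintype B] [DecidableEq B] [Group W] [Finite W] {M : CoxeterMatrix B}
  {cs : CoxeterSystem M W} {d : B → Set.Ioi (0 : ℝ)}

theorem isMovedMap_moved (hd : HasReducedRoots cs d) {c : W} (hc : cs.IsCoxeterElement c) :
    IsMovedMap cs c (cs.moved d) (cs.IsRootOf d) (cs.geomRep d) where
  conj := moved_conj cs d
  inv := moved_inv cs d
  eq_bot_iff _ := moved_eq_bot_iff_of_absLE hc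
  eq_top_iff _ := moved_eq_top_iff_of_absLE hc
  root g _ _ h := isRootOf_geomRep h g
  root_unique _ _ _ := hd.eq_or_eq_neg_of_isRootOf
  simple := moved_simple cs d
  edge i j hij hM := by
    refine ⟨-M.simpleCoroot d i (simpleRoot j),
      neg_ne_zero.2 (simpleCoroot_simpleRoot_neg hij hM).ne, Or.inl ?_⟩
    rw [neg_smul, ← sub_eq_add_neg]
    exact geomRep_simple_apply cs d i (simpleRoot j)

end RealMovedSpaces

/-! ### Reduction modulo a prime -/

section LatticeReduction

variable {B : Type*}

theorem intVec_injective : Function.Injective (intVec : (B → ℤ) →+ (B → ℝ)) :=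
  Int.cast_injective.comp_left

theorem reduceMod_surjective (p : ℕ) :
    Function.Surjective (reduceMod p : (B → ℤ) →+ (B → ZMod p)) :=
  ZMod.intCast_surjective.comp_left

theorem exists_eq_nsmul_of_reduceMod_eq_zero {p : ℕ} {u : B → ℤ} (hu : reduceMod p u = 0) :
    ∃ v : B → ℤ, u = p • v := by
  choose v hv using fun i => (ZMod.intCast_zmod_eq_zero_iff_dvd (u i) p).1 (congrFun hu i)
  exact ⟨v, funext fun i => by rw [hv, Pi.smul_apply, nsmul_eq_mul]⟩

theorem intVec_single [DecidableEq B] (i : B) (a : ℤ) :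
    intVec (Pi.single i a) = Pi.single i (a : ℝ) :=
  funext fun j => Pi.apply_single (fun _ (n : ℤ) => (n : ℝ)) (fun _ => Int.cast_zero) i a j

theorem reduceMod_single [DecidableEq B] (p : ℕ) (i : B) (a : ℤ) :
    reduceMod p (Pi.single i a) = Pi.single i (a : ZMod p) :=
  funext fun j => Pi.apply_single (fun _ (n : ℤ) => (n : ZMod p)) (fun _ => Int.cast_zero) i a j

theorem exists_linearMap_reduceMod (p : ℕ) (N : (B → ℤ) →+ (B → ℤ)) :
    ∃ ψ : (B → ZMod p) →ₗ[ZMod p] (B → ZMod p), ∀ v, ψ (reduceMod p v) = reduceMod p (N v) := by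
  have ker_le : (reduceMod p).ker ≤ ((reduceMod p).comp N).ker := fun u hu => by
    obtain ⟨v, rfl⟩ := exists_eq_nsmul_of_reduceMod_eq_zero hu
    rw [AddMonoidHom.mem_ker, AddMonoidHom.comp_apply, map_nsmul, map_nsmul]
    exact funext fun i => by simp
  let ψ := (reduceMod p).liftOfSurjective (reduceMod_surjective p) ⟨(reduceMod p).comp N, ker_le⟩
  exact ⟨ψ.toZModLinearMap p, fun v =>
    (reduceMod p).liftOfRightInverse_comp_apply _
      (Function.rightInverse_surjInv (reduceMod_surjective p)) ⟨_, ker_le⟩ v⟩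

theorem exists_linearEquiv_reduceMod (p : ℕ) (N : (B → ℤ) ≃+ (B → ℤ)) :
    ∃ ψ : (B → ZMod p) ≃ₗ[ZMod p] (B → ZMod p), ∀ v, ψ (reduceMod p v) = reduceMod p (N v) := by
  obtain ⟨ψ, hψ⟩ := exists_linearMap_reduceMod p (N : (B → ℤ) →+ (B → ℤ))
  obtain ⟨ψ', hψ'⟩ := exists_linearMap_reduceMod p (N.symm : (B → ℤ) →+ (B → ℤ))
  refine ⟨LinearEquiv.ofLinearMap ψ ψ' (LinearMap.ext fun x => ?_) (LinearMap.ext fun x => ?_), hψ⟩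
  all_goals
    obtain ⟨v, rfl⟩ := reduceMod_surjective p x
    simp [hψ, hψ']

/-- The reduction modulo `p` of the group of integer vectors in a real subspace. -/
def latticeReduction (p : ℕ) (U : Submodule ℝ (B → ℝ)) : Submodule (ZMod p) (B → ZMod p) :=
  AddSubgroup.toZModSubmodule p ((U.toAddSubgroup.comap intVec).map (reduceMod p))

theorem mem_latticeReduction {p : ℕ} {U : Submodule ℝ (B → ℝ)} {x : B → ZMod p} :
    x ∈ latticeReduction p U ↔ ∃ u, intVec u ∈ U ∧ reduceMod p u = x :=
  Iff.rfl

theorem latticeReduction_map {p : ℕ} {T : (B → ℝ) ≃ₗ[ℝ] (B → ℝ)} {N : (B → ℤ) ≃+ (B → ℤ)}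
    {ψ : (B → ZMod p) ≃ₗ[ZMod p] (B → ZMod p)} (hN : ∀ v, intVec (N v) = T (intVec v))
    (hψ : ∀ v, ψ (reduceMod p v) = reduceMod p (N v)) (U : Submodule ℝ (B → ℝ)) :
    latticeReduction p (U.map (T : (B → ℝ) →ₗ[ℝ] (B → ℝ))) =
      (latticeReduction p U).map (ψ : (B → ZMod p) →ₗ[ZMod p] (B → ZMod p)) := by
  ext x
  simp only [Submodule.mem_map, mem_latticeReduction, LinearEquiv.coe_coe]
  constructor
  · rintro ⟨u, ⟨y, hy, hyu⟩, rfl⟩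
    obtain ⟨v, rfl⟩ := N.surjective u
    rw [hN, T.injective.eq_iff] at hyu
    exact ⟨_, ⟨v, hyu ▸ hy, rfl⟩, hψ v⟩
  · rintro ⟨_, ⟨v, hv, rfl⟩, rfl⟩
    exact ⟨N v, ⟨intVec v, hv, (hN v).symm⟩, (hψ v).symm⟩

theorem latticeReduction_span_single [DecidableEq B] (p : ℕ) (i : B) :
    latticeReduction p (ℝ ∙ (Pi.single i 1 : B → ℝ)) = ZMod p ∙ (Pi.single i 1 : B → ZMod p) := by
  ext x
  rw [mem_latticeReduction, Submodule.mem_span_singleton]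
  constructor
  · rintro ⟨u, hu, rfl⟩
    obtain ⟨a, ha⟩ := Submodule.mem_span_singleton.1 hu
    have u_eq_single : u = Pi.single i (u i) := by
      refine funext fun j => ?_
      rcases eq_or_ne j i with rfl | hj
      · rw [Pi.single_eq_same]
      · have hj_zero := congrFun ha j
        rw [Pi.smul_apply, Pi.single_eq_of_ne hj, smul_zero] at hj_zero
        rw [Pi.single_eq_of_ne hj]
        exact Int.cast_eq_zero.1 hj_zero.symm
    refine ⟨u i, ?_⟩
    rw [u_eq_single, reduceMod_single, Pi.single_eq_same, ← Pi.single_smul, smul_eq_mul, mul_one]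
  · rintro ⟨a, rfl⟩
    obtain ⟨n, rfl⟩ := ZMod.intCast_surjective a
    refine ⟨Pi.single i n, Submodule.mem_span_singleton.2 ⟨n, ?_⟩, ?_⟩
    · rw [intVec_single, ← Pi.single_smul, smul_eq_mul, mul_one]
    · rw [reduceMod_single, ← Pi.single_smul, smul_eq_mul, mul_one]

theorem eq_zero_of_latticeReduction_eq_bot {p : ℕ} (hp : 1 < p) {U : Submodule ℝ (B → ℝ)}
    (hU : latticeReduction p U = ⊥) {u : B → ℤ} (hu : intVec u ∈ U) : u = 0 := by
  -- Division by `p` stays in the subspace.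
  have pow_dvd : ∀ k u, intVec u ∈ U → ∀ i, (p : ℤ) ^ k ∣ u i := by
    intro k
    induction k with
    | zero => simp
    | succ k ih =>
      intro u hu i
      have hu_zero : reduceMod p u = 0 :=
        (Submodule.mem_bot (ZMod p)).1 (hU ▸ mem_latticeReduction.2 ⟨u, hu, rfl⟩)
      obtain ⟨v, rfl⟩ := exists_eq_nsmul_of_reduceMod_eq_zero hu_zero
      have hp_ne : (p : ℝ) ≠ 0 := by positivity
      have hv : intVec v ∈ U := by
        rwa [map_nsmul, ← Nat.cast_smul_eq_nsmul ℝ, U.smul_mem_iff hp_ne] at hu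
      rw [Pi.smul_apply, nsmul_eq_mul, pow_succ']
      exact mul_dvd_mul_left _ (ih v hv i)
  refine funext fun i => Int.eq_zero_of_abs_lt_dvd (pow_dvd (u i).natAbs u hu i) ?_
  rw [Int.abs_eq_natAbs]
  exact_mod_cast Nat.lt_pow_self hp

theorem latticeReduction_eq_top_iff [Finite B] {p : ℕ} (hp : 1 < p) {U : Submodule ℝ (B → ℝ)} :
    latticeReduction p U = ⊤ ↔ U = ⊤ := by
  classical
  have := Fintype.ofFinite B
  have : Fact (1 < p) := ⟨hp⟩
  constructor
  · intro hU
    choose u hu hred using fun i : B =>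
      mem_latticeReduction.1
        (hU ▸ Submodule.mem_top : (Pi.single i 1 : B → ZMod p) ∈ latticeReduction p U)
    have map_mod : (Matrix.of u).map (Int.castRingHom (ZMod p)) = 1 :=
      Matrix.ext fun i j => (congrFun (hred i) j).trans Matrix.one_eq_pi_single.symm
    have det_ne_zero : (Matrix.of u).det ≠ 0 := fun h => by
      have det_map := (Int.castRingHom (ZMod p)).map_det (Matrix.of u)
      rw [RingHom.mapMatrix_apply, map_mod, h, map_zero, Matrix.det_one] at det_map
      exact zero_ne_one det_map
    have isUnit_map : IsUnit ((Matrix.of u).map (Int.castRingHom ℝ)) := by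
      rw [Matrix.isUnit_iff_isUnit_det, ← RingHom.mapMatrix_apply, ← RingHom.map_det,
        isUnit_iff_ne_zero]
      exact Int.cast_ne_zero.2 det_ne_zero
    have linearIndependent := Matrix.linearIndependent_rows_iff_isUnit.2 isUnit_map
    rw [eq_top_iff, ← linearIndependent.span_eq_top_of_card_eq_finrank' (by simp),
      Submodule.span_le]
    rintro _ ⟨i, rfl⟩
    exact hu i
  · rintro rfl
    refine eq_top_iff.2 fun x _ => ?_
    obtain ⟨u, rfl⟩ := reduceMod_surjective p x
    exact mem_latticeReduction.2 ⟨u, Submodule.mem_top, rfl⟩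

end LatticeReduction

section ModMovedSpaces

variable {B W : Type*} [Fintype B] [DecidableEq B] [Group W] {M : CoxeterMatrix B}
  {cs : CoxeterSystem M W} {d : B → Set.Ioi (0 : ℝ)} {p : ℕ}

theorem modMoved_eq_latticeReduction (w : W) :
    cs.modMoved d p w = latticeReduction p (cs.moved d w) :=
  rfl

theorem exists_addEquiv_intVec_eq_simple (hd : cs.IsCrystallographic d) (i : B) :
    ∃ N : (B → ℤ) ≃+ (B → ℤ), ∀ v, intVec (N v) = cs.geomRep d (cs.simple i) (intVec v) := by
  choose n hn using exists_simpleCoroot_simpleRoot_eq_int hd i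
  have hn_self : n i = 2 := by exact_mod_cast (hn i).symm.trans (simpleCoroot_self d i)
  let f : Module.Dual ℤ (B → ℤ) := ∑ j, n j • LinearMap.proj j
  have hf : f (Pi.single i 1) = 2 := by simp [f, Pi.single_apply, hn_self]
  have simpleCoroot_intVec : ∀ v, M.simpleCoroot d i (intVec v) = f v := fun v => by
    have intVec_eq_sum : intVec v = ∑ j, (v j : ℝ) • simpleRoot j :=
      pi_eq_sum_univ' (intVec v)
    simp [intVec_eq_sum, map_sum, hn, f, mul_comm]
  refine ⟨(Module.reflection hf).toAddEquiv, fun v => ?_⟩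
  change intVec (Module.reflection hf v) = _
  rw [geomRep_simple_apply, simpleCoroot_intVec, Module.reflection_apply, map_sub,
    map_zsmul, intVec_single, Int.cast_one, Int.cast_smul_eq_zsmul]
  rfl

theorem exists_addEquiv_intVec_eq (hd : cs.IsCrystallographic d) (g : W) :
    ∃ N : (B → ℤ) ≃+ (B → ℤ), ∀ v, intVec (N v) = cs.geomRep d g (intVec v) := by
  induction g using cs.simple_induction with
  | simple i => exact exists_addEquiv_intVec_eq_simple hd i
  | one => exact ⟨AddEquiv.refl _, fun v => by rw [map_one]; rfl⟩
  | mul g g' h h' =>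
    obtain ⟨N, hN⟩ := h
    obtain ⟨N', hN'⟩ := h'
    exact ⟨N'.trans N, fun v => by
      rw [AddEquiv.trans_apply, hN, hN', map_mul, LinearEquiv.mul_apply]⟩

theorem modMoved_eq_bot_iff (hd : cs.IsCrystallographic d) (hp : 1 < p) {w : W} :
    cs.modMoved d p w = ⊥ ↔ cs.moved d w = ⊥ := by
  rw [modMoved_eq_latticeReduction]
  constructor
  · intro h
    obtain ⟨N, hN⟩ := exists_addEquiv_intVec_eq hd w
    have fixes_single : ∀ i, cs.geomRep d w (Pi.single i 1) = Pi.single i 1 := fun i => by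
      have h_moved : intVec (N (Pi.single i 1) - Pi.single i 1) ∈ cs.moved d w :=
        mem_movedSpace.2 ⟨intVec (Pi.single i 1), by rw [map_sub, hN]⟩
      have h_fixed := sub_eq_zero.1 (eq_zero_of_latticeReduction_eq_bot hp h h_moved)
      simpa only [h_fixed, intVec_single, Int.cast_one] using (hN (Pi.single i 1)).symm
    have geomRep_eq_one : cs.geomRep d w = 1 :=
      (Pi.basisFun ℝ B).ext' fun i => by rw [Pi.basisFun_apply, fixes_single]; rfl
    rw [moved_eq_movedSpace, geomRep_eq_one, movedSpace_one]
  · intro h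
    refine eq_bot_iff.2 fun x hx => ?_
    obtain ⟨u, hu, rfl⟩ := mem_latticeReduction.1 hx
    rw [h, Submodule.mem_bot, map_eq_zero_iff _ intVec_injective] at hu
    rw [hu, map_zero, Submodule.mem_bot]

theorem exists_isMovedMap_modMoved [Finite W] [Fact p.Prime] (hd : cs.IsCrystallographic d)
    {c : W} (hc : cs.IsCoxeterElement c) :
    ∃ ρ, IsMovedMap cs c (cs.modMoved d p) (cs.IsModRootOf d p) ρ := by
  have hp : 1 < p := (Fact.out : p.Prime).one_lt
  choose N hN using exists_addEquiv_intVec_eq hd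
  choose ρ hρ using fun g => exists_linearEquiv_reduceMod p (N g)
  have ρ_simple : ∀ i j, cs.geomRep d (cs.simple i) (simpleRoot j) = simpleRoot j + simpleRoot i →
      ρ (cs.simple i) (Pi.single j 1) = Pi.single j 1 + (1 : ZMod p) • Pi.single i 1 := by
    intro i j h
    have h_int : N (cs.simple i) (Pi.single j 1) = Pi.single j 1 + Pi.single i 1 :=
      intVec_injective (by simpa [hN, intVec_single, simpleRoot] using h)
    simpa [h_int, reduceMod_single] using hρ (cs.simple i) (Pi.single j 1)
  refine ⟨ρ, ?conj, ?inv, ?bot, ?top, ?root, ?root_unique, ?simple, ?edge⟩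
  case conj =>
    intro g w
    simp only [modMoved_eq_latticeReduction, moved_conj, latticeReduction_map (hN g) (hρ g)]
  case inv =>
    intro w
    simp only [modMoved_eq_latticeReduction, moved_inv]
  case bot => exact fun w hw => (modMoved_eq_bot_iff hd hp).trans (moved_eq_bot_iff_of_absLE hc hw)
  case top =>
    exact fun w hw => (latticeReduction_eq_top_iff hp).trans (moved_eq_top_iff_of_absLE hc hw)
  case root =>
    rintro g t _ ⟨α, hα, rfl⟩
    exact ⟨N g α, hN g α ▸ isRootOf_geomRep hα g, hρ g α⟩
  case root_unique =>
    rintro t _ _ ⟨α, hα, rfl⟩ ⟨β, hβ, rfl⟩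
    rcases HasReducedRoots.eq_or_eq_neg_of_isRootOf hd.reduced hα hβ with h | h
    · exact Or.inl (congrArg _ (intVec_injective h))
    · rw [← map_neg] at h
      exact Or.inr (by rw [intVec_injective h, map_neg])
  case simple =>
    intro i
    rw [modMoved_eq_latticeReduction, moved_simple]
    exact latticeReduction_span_single p i
  case edge =>
    exact fun i j hij hM => ⟨1, one_ne_zero,
      (geomRep_simple_simpleRoot_eq_add hd hij hM).imp (ρ_simple i j) (ρ_simple j i)⟩

end ModMovedSpaces

end NoncrossingPartitions

theorem mainTheorem4_general {B W : Type*} [Fintype B] [DecidableEq B] [Group W] [Finite W]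
    {M : CoxeterMatrix B} (cs : CoxeterSystem M W) {c : W} (hc : cs.IsCoxeterElement c)
    {φ : cs.NC c ≃o cs.NC c} (hφ : φ ∈ NoncrossingPartitions.conjugationAut cs c) :
    (∀ d, NoncrossingPartitions.HasReducedRoots cs d →
      cs.ExtendsUniquely (fun w => cs.moved d w.val) (cs.IsRootOf d) φ) ∧
    ∀ d, cs.IsCrystallographic d → ∀ (p : ℕ) [Fact p.Prime],
      cs.ExtendsUniquely (fun w => cs.modMoved d p w.val) (cs.IsModRootOf d p) φ := by
  refine ⟨fun d hd => (NoncrossingPartitions.isMovedMap_moved hd hc).extendsUniquely hc hφ, ?_⟩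
  intro d hd p _
  obtain ⟨ρ, hρ⟩ := NoncrossingPartitions.exists_isMovedMap_modMoved (p := p) hd hc
  exact hρ.extendsUniquely hc hφ

theorem mainTheorem4 {B W : Type*} [Fintype B] [DecidableEq B] [Group W] [Finite W]
    {M : CoxeterMatrix B} (cs : CoxeterSystem M W) (c l r : W) (hc : cs.IsCoxeterElement c)
    (h : CoxeterSystem.IsBipartition c l r) (φ : cs.NC c ≃o cs.NC c)
    (hφ : φ ∈ cs.dihedralAut h) :
    cs.ExtendsUniquely (fun w => cs.moved CoxeterSystem.unitLengths w.val)
      (cs.IsRootOf CoxeterSystem.unitLengths) φ ∧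
    ∀ d : B → Set.Ioi (0 : ℝ), cs.IsCrystallographic d →
      ∀ p : ℕ, [Fact p.Prime] → cs.IsCompatible d p →
        cs.ExtendsUniquely (fun w => cs.modMoved d p w.val) (cs.IsModRootOf d p) φ := by
  have H := mainTheorem4_general cs hc
    (NoncrossingPartitions.dihedralAut_le_conjugationAut h hφ)
  exact ⟨H.1 _ (NoncrossingPartitions.hasReducedRoots_unitLengths cs), fun d hd p _ _ => H.2 d hd p⟩
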